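/- Let $n\ge 3$, let $g$ be a $C^2$ Riemannian metric of positive sectional curvature on the sphere $\mathbb S^n$, and let $X\colon(\mathbb S^n,g)\to\mathbb R^{n+1}$ be a $C^2$ isometric embedding. Let $\chi$ be the second fundamental form of $X$, i.e. in local coordinates $\chi_{ij}=-\langle\partial_i\partial_jX,N\rangle$, where $N$ is a unit normal of $X$ (its choice, outer or inner, does not affect $|\chi|$). Let $\kappa$ be the minimum of all the sectional curvatures of $g$ over all tangent planes at all points of $\mathbb S^n$, and let $\Lambda$ be the maximum over $\mathbb S^n$ of the norm $|\mathrm{Ric}|=(R_{ij}R^{ij})^{1/2}$ of the Ricci tensor of $g$ (both are attained). Then at every point of $\mathbb S^n$ $$|\chi|=(\chi_{ij}\chi^{ij})^{1/2}\le C_n\,\Lambda\,\kappa^{-1/2},\qquad C_n=\frac{n}{2\sqrt{(n-1)(n-2)}},$$ where indices are raised with $g$. -/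

import Mathlib

open scoped Manifold ContDiff RealInnerProductSpace

noncomputable section

/-- The standard sphere `S^n`, the unit sphere of `ℝ^{n+1}` with Mathlib's smooth structure. -/
abbrev Sn (n : ℕ) : Type := Metric.sphere (0 : EuclideanSpace ℝ (Fin (n + 1))) 1

/-- A `C^2` Riemannian metric on `S^n`. -/
abbrev C2Metric (n : ℕ) : Type :=
  Bundle.ContMDiffRiemannianMetric (𝓡 n) 2 (EuclideanSpace ℝ (Fin n))
    (fun p : Sn n => TangentSpace (𝓡 n) p)

/-! ### Local Riemannian geometry in coordinates

`G : EuclideanSpace ℝ (Fin n) → Matrix (Fin n) (Fin n) ℝ` is the matrix `g_{ij}` of a metric in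
local coordinates. -/

/-- The `i`-th partial derivative `∂_i f` at `x`. -/
def partialDeriv {n : ℕ} {F : Type*} [NormedAddCommGroup F] [NormedSpace ℝ F] (i : Fin n)
    (f : EuclideanSpace ℝ (Fin n) → F) (x : EuclideanSpace ℝ (Fin n)) : F :=
  fderiv ℝ f x (EuclideanSpace.single i 1)

/-- The Christoffel symbol `Γ^k_{ij} = ½ g^{kl} (∂_i g_{jl} + ∂_j g_{il} - ∂_l g_{ij})`. -/
def christoffel {n : ℕ} (G : EuclideanSpace ℝ (Fin n) → Matrix (Fin n) (Fin n) ℝ)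
    (k i j : Fin n) (x : EuclideanSpace ℝ (Fin n)) : ℝ :=
  (1 / 2) * ∑ l, (G x)⁻¹ k l *
    (partialDeriv i (fun y => G y j l) x + partialDeriv j (fun y => G y i l) x
      - partialDeriv l (fun y => G y i j) x)

/-- The component along `∂_m` of
`R(∂_i, ∂_j) ∂_l = ∇_{∂_i} ∇_{∂_j} ∂_l - ∇_{∂_j} ∇_{∂_i} ∂_l`. -/
def riemannUp {n : ℕ} (G : EuclideanSpace ℝ (Fin n) → Matrix (Fin n) (Fin n) ℝ)
    (m i j l : Fin n) (x : EuclideanSpace ℝ (Fin n)) : ℝ :=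
  partialDeriv i (christoffel G m j l) x - partialDeriv j (christoffel G m i l) x
    + ∑ a, (christoffel G m i a x * christoffel G a j l x
      - christoffel G m j a x * christoffel G a i l x)

/-- The Riemann tensor `R_{ijkl} = ⟨R(∂_i, ∂_j) ∂_l, ∂_k⟩`; with this convention the sectional
curvature of the plane spanned by orthonormal `∂_i, ∂_j` is `R_{ijij}`. -/
def riemann {n : ℕ} (G : EuclideanSpace ℝ (Fin n) → Matrix (Fin n) (Fin n) ℝ)
    (i j k l : Fin n) (x : EuclideanSpace ℝ (Fin n)) : ℝ :=
  ∑ m, G x k m * riemannUp G m i j l x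

/-- The Ricci tensor `R_{jl} = g^{ik} R_{ijkl}`. -/
def ricci {n : ℕ} (G : EuclideanSpace ℝ (Fin n) → Matrix (Fin n) (Fin n) ℝ)
    (x : EuclideanSpace ℝ (Fin n)) : Matrix (Fin n) (Fin n) ℝ :=
  fun j l => ∑ i, ∑ k, (G x)⁻¹ i k * riemann G i j k l x

/-- The sectional curvature at `x` of the plane spanned by `u = u^i ∂_i` and `v = v^i ∂_i`:
`R_{ijkl} u^i v^j u^k v^l / (|u|² |v|² - ⟨u, v⟩²)`. -/
def sectional {n : ℕ} (G : EuclideanSpace ℝ (Fin n) → Matrix (Fin n) (Fin n) ℝ)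
    (x : EuclideanSpace ℝ (Fin n)) (u v : Fin n → ℝ) : ℝ :=
  (∑ i, ∑ j, ∑ k, ∑ l, riemann G i j k l x * u i * v j * u k * v l) /
    ((u ⬝ᵥ (G x).mulVec u) * (v ⬝ᵥ (G x).mulVec v) - (u ⬝ᵥ (G x).mulVec v) ^ 2)

/-- The norm `(T_{ij} T^{ij})^{1/2} = (g^{ik} g^{jl} T_{ij} T_{kl})^{1/2}` of a twice covariant
tensor `T` with respect to the metric with matrix `A = (g_{ij})`. -/
def tensorNorm {n : ℕ} (A T : Matrix (Fin n) (Fin n) ℝ) : ℝ :=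
  Real.sqrt (∑ i, ∑ j, ∑ k, ∑ l, A⁻¹ i k * A⁻¹ j l * T i j * T k l)

/-! ### Metrics and hypersurfaces on the sphere -/

/-- The matrix `g_{ij}(x) = g(∂_i, ∂_j)` of `g` in the coordinates of the chart centred at `p`,
where `∂_i` is the image of the `i`-th standard vector under the differential of the inverse
chart. -/
def chartMetric {n : ℕ} (g : C2Metric n) (p : Sn n) (x : EuclideanSpace ℝ (Fin n)) :
    Matrix (Fin n) (Fin n) ℝ :=
  fun i j => g.inner ((extChartAt (𝓡 n) p).symm x)
    (mfderiv 𝓘(ℝ, EuclideanSpace ℝ (Fin n)) (𝓡 n) (extChartAt (𝓡 n) p).symm x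
      (EuclideanSpace.single i (1 : ℝ)))
    (mfderiv 𝓘(ℝ, EuclideanSpace ℝ (Fin n)) (𝓡 n) (extChartAt (𝓡 n) p).symm x
      (EuclideanSpace.single j (1 : ℝ)))

/-- The set of all sectional curvatures of `(S^n, g)`, over all points `p` and all tangent planes
at `p`. -/
def sectionalCurvatures {n : ℕ} (g : C2Metric n) : Set ℝ :=
  {k | ∃ (p : Sn n) (u v : Fin n → ℝ), LinearIndependent ℝ ![u, v] ∧
    k = sectional (chartMetric g p) (extChartAt (𝓡 n) p p) u v}

/-- The norm `|Ric| = (R_{ij} R^{ij})^{1/2}` at `p`. -/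
def ricciNorm {n : ℕ} (g : C2Metric n) (p : Sn n) : ℝ :=
  tensorNorm (chartMetric g p (extChartAt (𝓡 n) p p))
    (ricci (chartMetric g p) (extChartAt (𝓡 n) p p))

/-- `X` is a `C^2` isometric embedding `(S^n, g) → ℝ^{n+1}`: a `C^2` topological embedding that
pulls the Euclidean inner product back to `g` (in particular, its differential is injective). -/
structure IsC2IsometricEmbedding {n : ℕ} (g : C2Metric n)
    (X : Sn n → EuclideanSpace ℝ (Fin (n + 1))) : Prop where
  contMDiff : ContMDiff (𝓡 n) 𝓘(ℝ, EuclideanSpace ℝ (Fin (n + 1))) 2 X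
  isEmbedding : Topology.IsEmbedding X
  isometric : ∀ (p : Sn n) (u v : TangentSpace (𝓡 n) p),
    inner ℝ (mvfderiv (𝓡 n) X p u) (mvfderiv (𝓡 n) X p v) = g.inner p u v

/-- `N` is a unit normal of `X` at `p`. (For an embedding there are exactly two, the outer one and
its negative.) -/
structure IsUnitNormal {n : ℕ} (X : Sn n → EuclideanSpace ℝ (Fin (n + 1))) (p : Sn n)
    (N : EuclideanSpace ℝ (Fin (n + 1))) : Prop where
  norm_eq_one : ‖N‖ = 1
  orthogonal : ∀ u : TangentSpace (𝓡 n) p,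
    inner ℝ (mvfderiv (𝓡 n) X p u) N = 0

/-- The second fundamental form `χ_{ij} = -⟨∂_i ∂_j X, N⟩` of `X` at `p` with respect to the unit
normal `N`, in the coordinates of the chart centred at `p`. -/
def secondFundamentalForm {n : ℕ} (X : Sn n → EuclideanSpace ℝ (Fin (n + 1))) (p : Sn n)
    (N : EuclideanSpace ℝ (Fin (n + 1))) : Matrix (Fin n) (Fin n) ℝ :=
  fun i j => -inner ℝ
    (partialDeriv i (partialDeriv j (X ∘ (extChartAt (𝓡 n) p).symm)) (extChartAt (𝓡 n) p p)) N

/-- The norm `|χ| = (χ_{ij} χ^{ij})^{1/2}` at `p`, taken with respect to `g`. -/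
def secondFundamentalFormNorm {n : ℕ} (g : C2Metric n)
    (X : Sn n → EuclideanSpace ℝ (Fin (n + 1))) (p : Sn n)
    (N : EuclideanSpace ℝ (Fin (n + 1))) : ℝ :=
  tensorNorm (chartMetric g p (extChartAt (𝓡 n) p p)) (secondFundamentalForm X p N)

end

/-!
By the Gauss equation the Riemann tensor of `g` is determined by the first and second fundamental
forms. In an orthonormal basis diagonalizing `χ`, with principal curvatures `d_i`, the sectional
curvatures of the coordinate planes are `d_i d_j ≥ κ` and the Ricci tensor is diagonal with
entries `d_i s_i`, where `s_i = ∑_{j ≠ i} d_j`. Hence `s_i² ≥ ∑_{j ≠ k} d_j d_k ≥ (n-1)(n-2) κ`,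
the sum being over indices distinct from `i`, so that `|Ric|² = ∑ d_i² s_i² ≥ (n-1)(n-2) κ |χ|²`;
and `n / 2 ≥ 1`.

As `X` is only `C²`, the Gauss equation is obtained by differentiating `Γ`, which is `C¹` since `g`
is `C²`, rather than the third derivatives of `X`. The extrema of the curvatures are attained
because they are the extrema of continuous functions on the compact manifold of orthonormal frames.
-/

/-! ### Partial derivatives -/

theorem hasFDerivAt_inner_of_continuousAt {E F : Type*} [NormedAddCommGroup E] [NormedSpace ℝ E]
    [NormedAddCommGroup F] [InnerProductSpace ℝ F] {a b : E → F} {b' : E →L[ℝ] F} {x : E}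
    (ha : ContinuousAt a x) (hb : HasFDerivAt b b' x) (hbx : b x = 0) :
    HasFDerivAt (fun y => ⟪a y, b y⟫) (innerSL ℝ (a x) ∘L b') x := by
  have h_const : HasFDerivAt (fun y => ⟪a x, b y⟫) (innerSL ℝ (a x) ∘L b') x :=
    (innerSL ℝ (a x)).hasFDerivAt.comp x hb
  have h_rem : HasFDerivAt (fun y => ⟪a y - a x, b y⟫) (0 : E →L[ℝ] ℝ) x := by
    have ha_o : (fun y => a y - a x) =o[nhds x] fun _ => (1 : ℝ) :=
      (Asymptotics.isLittleO_one_iff ℝ).2 (tendsto_sub_nhds_zero_iff.2 ha)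
    have hb_O : b =O[nhds x] fun y => y - x := by simpa [hbx] using hb.isBigO_sub
    have h_inner : (fun y => ⟪a y - a x, b y⟫) =O[nhds x] fun y => ‖a y - a x‖ * ‖b y‖ :=
      .of_bound 1 (.of_forall fun y => by simpa using abs_real_inner_le_norm (a y - a x) (b y))
    have h_o := h_inner.trans_isLittleO (ha_o.norm_left.mul_isBigO hb_O.norm_norm)
    simpa [hasFDerivAt_iff_isLittleO, hbx, Asymptotics.isLittleO_norm_right] using h_o
  refine ((h_const.add h_rem).congr_fderiv (add_zero _)).congr_of_eventuallyEq (.of_forall ?_)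
  intro y
  simp [inner_sub_left]

section PartialDeriv

variable {n : ℕ} {F : Type*} [NormedAddCommGroup F] [NormedSpace ℝ F]
  {f : EuclideanSpace ℝ (Fin n) → F} {x : EuclideanSpace ℝ (Fin n)}

theorem partialDeriv_eq_of_hasFDerivAt {f' : EuclideanSpace ℝ (Fin n) →L[ℝ] F}
    (hf : HasFDerivAt f f' x) (i : Fin n) :
    partialDeriv i f x = f' (EuclideanSpace.single i 1) := by
  rw [partialDeriv, hf.fderiv]

theorem fderiv_eq_sum_partialDeriv (f : EuclideanSpace ℝ (Fin n) → F)
    (x : EuclideanSpace ℝ (Fin n)) :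
    fderiv ℝ f x = ∑ j, (EuclideanSpace.proj (𝕜 := ℝ) j).smulRight (partialDeriv j f x) := by
  ext v
  conv_lhs => rw [← (EuclideanSpace.basisFun (Fin n) ℝ).sum_repr v]
  simp [partialDeriv]

theorem partialDeriv_comm (hf : Differentiable ℝ f)
    (hf' : ∀ j, DifferentiableAt ℝ (partialDeriv j f) x) (i j : Fin n) :
    partialDeriv i (partialDeriv j f) x = partialDeriv j (partialDeriv i f) x := by
  have h : HasFDerivAt (fderiv ℝ f) (∑ j, (ContinuousLinearMap.smulRightL ℝ _ F
      (EuclideanSpace.proj j)) ∘L fderiv ℝ (partialDeriv j f) x) x := by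
    rw [show fderiv ℝ f = _ from funext (fderiv_eq_sum_partialDeriv f)]
    exact HasFDerivAt.fun_sum fun j _ =>
      (ContinuousLinearMap.hasFDerivAt (ContinuousLinearMap.smulRightL ℝ _ F
        (EuclideanSpace.proj j))).comp x (hf' j).hasFDerivAt
  simpa [partialDeriv] using second_derivative_symmetric (fun y => (hf y).hasFDerivAt) h
    (EuclideanSpace.single i 1) (EuclideanSpace.single j 1)

theorem contDiff_partialDeriv (hf : ContDiff ℝ 2 f) (i : Fin n) :
    ContDiff ℝ 1 (partialDeriv i f) :=
  (hf.fderiv_right (m := 1) (by norm_num)).clm_apply contDiff_const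

theorem differentiable_partialDeriv (hf : ContDiff ℝ 2 f) (i : Fin n) :
    Differentiable ℝ (partialDeriv i f) :=
  (contDiff_partialDeriv hf i).differentiable one_ne_zero

theorem partialDeriv_partialDeriv (hf : ContDiff ℝ 2 f) (i j : Fin n)
    (x : EuclideanSpace ℝ (Fin n)) :
    partialDeriv i (partialDeriv j f) x =
      fderiv ℝ (fderiv ℝ f) x (EuclideanSpace.single i 1) (EuclideanSpace.single j 1) := by
  have h := ((hf.fderiv_right (m := 1) (by norm_num)).differentiable one_ne_zero x).hasFDerivAt
  exact (partialDeriv_eq_of_hasFDerivAt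
    (h.clm_apply (hasFDerivAt_const (EuclideanSpace.single j 1) x)) i).trans (by simp)

theorem partialDeriv_inner {F : Type*} [NormedAddCommGroup F] [InnerProductSpace ℝ F]
    {A B : EuclideanSpace ℝ (Fin n) → F} (hA : DifferentiableAt ℝ A x)
    (hB : DifferentiableAt ℝ B x) (i : Fin n) :
    partialDeriv i (fun y => ⟪A y, B y⟫) x =
      ⟪partialDeriv i A x, B x⟫ + ⟪A x, partialDeriv i B x⟫ := by
  rw [partialDeriv, fderiv_inner_apply ℝ hA hB, add_comm]
  rfl

theorem partialDeriv_sum_mul {ι : Type*} {s : Finset ι} {a b : ι → EuclideanSpace ℝ (Fin n) → ℝ}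
    (ha : ∀ m ∈ s, DifferentiableAt ℝ (a m) x) (hb : ∀ m ∈ s, DifferentiableAt ℝ (b m) x)
    (i : Fin n) :
    partialDeriv i (fun y => ∑ m ∈ s, a m y * b m y) x =
      ∑ m ∈ s, (partialDeriv i (a m) x * b m x + a m x * partialDeriv i (b m) x) := by
  rw [partialDeriv_eq_of_hasFDerivAt (HasFDerivAt.fun_sum fun m hm =>
    (ha m hm).hasFDerivAt.fun_mul (hb m hm).hasFDerivAt)]
  simp [partialDeriv, mul_comm, add_comm]

/-- For `A` of class `C^2` this follows from the product rule and the symmetry of second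
derivatives. Below `A` and `B` are first derivatives of a `C^2` map, so that no third derivatives
exist, but the left-hand sides do since they are derivatives of Christoffel symbols. -/
theorem partialDeriv_inner_partialDeriv_sub {F : Type*} [NormedAddCommGroup F]
    [InnerProductSpace ℝ F] {A B : EuclideanSpace ℝ (Fin n) → F} (hA : ContDiff ℝ 1 A)
    (hB : DifferentiableAt ℝ B x)
    (hAB : ∀ j, DifferentiableAt ℝ (fun y => ⟪partialDeriv j A y, B y⟫) x) (i j : Fin n) :
    partialDeriv i (fun y => ⟪partialDeriv j A y, B y⟫) x
      - partialDeriv j (fun y => ⟪partialDeriv i A y, B y⟫) x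
      = ⟪partialDeriv j A x, partialDeriv i B x⟫ - ⟪partialDeriv i A x, partialDeriv j B x⟫ := by
  have hAd : Differentiable ℝ A := hA.differentiable one_ne_zero
  have h_partial : ∀ j, partialDeriv j (fun y => ⟪A y, B x⟫) =
      fun y => ⟪partialDeriv j A y, B x⟫ := fun j => funext fun y => by
    simpa [partialDeriv] using partialDeriv_inner (hAd y) (differentiableAt_const (B x)) j
  have h_rem : ∀ j, HasFDerivAt (fun y => ⟪partialDeriv j A y, B y - B x⟫)
      (innerSL ℝ (partialDeriv j A x) ∘L fderiv ℝ B x) x := fun j =>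
    hasFDerivAt_inner_of_continuousAt
      ((hA.continuous_fderiv one_ne_zero).clm_apply continuous_const).continuousAt
      (hB.hasFDerivAt.sub_const _) (sub_self _)
  have h_second : ∀ j, HasFDerivAt (partialDeriv j fun y => ⟪A y, B x⟫)
      (fderiv ℝ (fun y => ⟪partialDeriv j A y, B y⟫) x
        - innerSL ℝ (partialDeriv j A x) ∘L fderiv ℝ B x) x := fun j => by
    refine ((hAB j).hasFDerivAt.sub (h_rem j)).congr_of_eventuallyEq (.of_forall fun y => ?_)
    simp [h_partial, inner_sub_right]
  have h_comm := partialDeriv_comm (fun y => (hAd y).inner ℝ (differentiableAt_const (B x)))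
    (fun j => (h_second j).differentiableAt) i j
  rw [partialDeriv_eq_of_hasFDerivAt (h_second j), partialDeriv_eq_of_hasFDerivAt (h_second i)]
    at h_comm
  simp only [sub_apply, ContinuousLinearMap.comp_apply, innerSL_apply_apply] at h_comm
  simp only [partialDeriv] at h_comm ⊢
  linarith

end PartialDeriv

/-! ### The Gauss equation -/

theorem differentiableAt_matrix_det {E m : Type*} [NormedAddCommGroup E] [NormedSpace ℝ E]
    [Fintype m] [DecidableEq m] {A : E → Matrix m m ℝ} {x : E}
    (hA : ∀ i j, DifferentiableAt ℝ (fun y => A y i j) x) :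
    DifferentiableAt ℝ (fun y => (A y).det) x := by
  simp only [Matrix.det_apply]
  fun_prop

theorem differentiableAt_matrix_inv_apply {E m : Type*} [NormedAddCommGroup E] [NormedSpace ℝ E]
    [Fintype m] [DecidableEq m] {A : E → Matrix m m ℝ} {x : E}
    (hA : ∀ i j, DifferentiableAt ℝ (fun y => A y i j) x) (hdet : IsUnit (A x).det) (i j : m) :
    DifferentiableAt ℝ (fun y => (A y)⁻¹ i j) x := by
  have h_adjugate : DifferentiableAt ℝ (fun y => (A y).adjugate i j) x := by
    simp only [Matrix.adjugate_apply]
    refine differentiableAt_matrix_det fun a b => ?_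
    by_cases h : a = j <;> simp [Matrix.updateRow_apply, h, hA]
  simp only [Matrix.inv_def, Ring.inverse_eq_inv', Matrix.smul_apply, smul_eq_mul]
  exact ((differentiableAt_matrix_det hA).inv hdet.ne_zero).mul h_adjugate

/-- The Christoffel symbol of the first kind
`Γ_{ij,k} = ½ (∂_i g_{jk} + ∂_j g_{ik} - ∂_k g_{ij})`, with the index `k` in front as in
`christoffel`. -/
noncomputable def christoffelFirst {n : ℕ}
    (G : EuclideanSpace ℝ (Fin n) → Matrix (Fin n) (Fin n) ℝ) (k i j : Fin n)
    (x : EuclideanSpace ℝ (Fin n)) : ℝ :=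
  (1 / 2) * (partialDeriv i (fun y => G y j k) x + partialDeriv j (fun y => G y i k) x
    - partialDeriv k (fun y => G y i j) x)

section Christoffel

variable {n : ℕ} {G : EuclideanSpace ℝ (Fin n) → Matrix (Fin n) (Fin n) ℝ}
  {x : EuclideanSpace ℝ (Fin n)}

theorem christoffel_eq_sum_christoffelFirst (k i j : Fin n) :
    christoffel G k i j x = ∑ l, (G x)⁻¹ k l * christoffelFirst G l i j x := by
  simp only [christoffel, christoffelFirst, Finset.mul_sum, mul_left_comm]

theorem sum_mul_christoffel (hdet : IsUnit (G x).det) (k i j : Fin n) :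
    ∑ m, G x k m * christoffel G m i j x = christoffelFirst G k i j x := by
  have h_up : (fun m => christoffel G m i j x) =
      (G x)⁻¹.mulVec fun l => christoffelFirst G l i j x :=
    funext fun m => christoffel_eq_sum_christoffelFirst m i j
  change (G x).mulVec (fun m => christoffel G m i j x) k = _
  rw [h_up, Matrix.mulVec_mulVec, Matrix.mul_nonsing_inv _ hdet, Matrix.one_mulVec]

theorem partialDeriv_eq_christoffelFirst_add (hG : ∀ y, (G y).IsSymm) (i k m : Fin n) :
    partialDeriv i (fun y => G y k m) x =
      christoffelFirst G m i k x + christoffelFirst G k i m x := by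
  have h_symm : (fun y => G y m k) = fun y => G y k m := funext fun y => (hG y).apply k m
  simp only [christoffelFirst, h_symm]
  ring

theorem differentiableAt_christoffelFirst (hG : ∀ i j, ContDiff ℝ 2 fun y => G y i j)
    (k i j : Fin n) : DifferentiableAt ℝ (christoffelFirst G k i j) x := by
  have h : ∀ a b c, DifferentiableAt ℝ (partialDeriv a fun y => G y b c) x := fun a b c =>
    differentiable_partialDeriv (hG b c) a x
  exact (((h i j k).add (h j i k)).sub (h k i j)).const_mul _

theorem differentiableAt_christoffel (hG : ∀ i j, ContDiff ℝ 2 fun y => G y i j)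
    (hdet : IsUnit (G x).det) (k i j : Fin n) : DifferentiableAt ℝ (christoffel G k i j) x := by
  rw [show christoffel G k i j = _ from
    funext fun y => christoffel_eq_sum_christoffelFirst (x := y) k i j]
  exact DifferentiableAt.fun_sum fun l _ => (differentiableAt_matrix_inv_apply
    (fun a b => (hG a b).differentiable two_ne_zero x) hdet k l).mul
      (differentiableAt_christoffelFirst hG l i j)

theorem sum_mul_partialDeriv_christoffel (hG : ∀ i j, ContDiff ℝ 2 fun y => G y i j)
    (hsymm : ∀ y, (G y).IsSymm) (hdet : ∀ y, IsUnit (G y).det) (k i j l : Fin n) :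
    ∑ m, G x k m * partialDeriv i (christoffel G m j l) x =
      partialDeriv i (christoffelFirst G k j l) x
        - ∑ m, (christoffelFirst G m i k x + christoffelFirst G k i m x) *
            christoffel G m j l x := by
  have h_leibniz := partialDeriv_sum_mul (s := Finset.univ)
    (fun m _ => (hG k m).differentiable two_ne_zero x)
    (fun m _ => differentiableAt_christoffel hG (hdet x) m j l) i
  simp only [sum_mul_christoffel (hdet _), partialDeriv_eq_christoffelFirst_add hsymm,
    Finset.sum_add_distrib] at h_leibniz
  exact eq_sub_of_add_eq' h_leibniz.symm

theorem sum_mul_sum_christoffel_mul (hdet : IsUnit (G x).det) (k i j l : Fin n) :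
    ∑ m, G x k m * ∑ a, christoffel G m i a x * christoffel G a j l x =
      ∑ a, christoffelFirst G k i a x * christoffel G a j l x := by
  simp only [← sum_mul_christoffel hdet k i, Finset.mul_sum, Finset.sum_mul, mul_assoc]
  exact Finset.sum_comm

theorem riemann_eq_christoffelFirst (hG : ∀ i j, ContDiff ℝ 2 fun y => G y i j)
    (hsymm : ∀ y, (G y).IsSymm) (hdet : ∀ y, IsUnit (G y).det) (i j k l : Fin n) :
    riemann G i j k l x =
      partialDeriv i (christoffelFirst G k j l) x - partialDeriv j (christoffelFirst G k i l) x
        - (∑ m, christoffelFirst G m i k x * christoffel G m j l x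
          - ∑ m, christoffelFirst G m j k x * christoffel G m i l x) := by
  simp only [riemann, riemannUp, mul_add, mul_sub, Finset.sum_add_distrib, Finset.sum_sub_distrib,
    sum_mul_partialDeriv_christoffel hG hsymm hdet, sum_mul_sum_christoffel_mul (hdet x), add_mul]
  ring

end Christoffel

theorem eq_zero_of_inner_eq_zero {ι F : Type*} [Fintype ι] [NormedAddCommGroup F]
    [InnerProductSpace ℝ F] (hF : Module.finrank ℝ F = Fintype.card ι + 1) {v : ι → F}
    (hv : LinearIndependent ℝ v) {N W : F} (hN : N ≠ 0) (hvN : ∀ i, ⟪v i, N⟫ = 0)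
    (hvW : ∀ i, ⟪v i, W⟫ = 0) (hNW : ⟪N, W⟫ = 0) : W = 0 := by
  have : FiniteDimensional ℝ F := .of_finrank_pos (hF ▸ Nat.succ_pos _)
  set S := Submodule.span ℝ (Set.range v)
  have h_mem : ∀ w : F, (∀ i, ⟪v i, w⟫ = 0) → w ∈ Sᗮ := fun w hw => by
    have h_le : S ≤ (ℝ ∙ w)ᗮ := Submodule.span_le.2 <| Set.range_subset_iff.2 fun i =>
      Submodule.mem_orthogonal_singleton_iff_inner_left.2 (hw i)
    exact fun u hu => Submodule.mem_orthogonal_singleton_iff_inner_left.1 (h_le hu)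
  have h_finrank : Module.finrank ℝ Sᗮ = 1 := by
    have h_span : Module.finrank ℝ S = Fintype.card ι := finrank_span_eq_card hv
    have := S.finrank_add_finrank_orthogonal
    omega
  obtain ⟨c, hc⟩ := (finrank_eq_one_iff_of_nonzero' (⟨N, h_mem N hvN⟩ : Sᗮ)
    (by simpa [Subtype.ext_iff] using hN)).1 h_finrank ⟨W, h_mem W hvW⟩
  obtain rfl : c • N = W := congrArg Subtype.val hc
  simpa [real_inner_smul_right, hN] using hNW

section Hypersurface

variable {n : ℕ} {F : Type*} [NormedAddCommGroup F] [InnerProductSpace ℝ F]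
  {Y : EuclideanSpace ℝ (Fin n) → F} {G : EuclideanSpace ℝ (Fin n) → Matrix (Fin n) (Fin n) ℝ}
  {x : EuclideanSpace ℝ (Fin n)} {N : F}

theorem christoffelFirst_eq_inner (hY : ContDiff ℝ 2 Y)
    (hG : ∀ y, G y = Matrix.gram ℝ fun i => partialDeriv i Y y) (k i j : Fin n) :
    christoffelFirst G k i j x = ⟪partialDeriv i (partialDeriv j Y) x, partialDeriv k Y x⟫ := by
  have hY' : ∀ a, DifferentiableAt ℝ (partialDeriv a Y) x := fun a =>
    differentiable_partialDeriv hY a x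
  have h_comm := partialDeriv_comm (hY.differentiable two_ne_zero) hY'
  simp only [christoffelFirst, hG, Matrix.gram_apply, partialDeriv_inner (hY' _) (hY' _)]
  rw [h_comm j i, h_comm k i, h_comm k j, real_inner_comm _ (partialDeriv i Y x),
    real_inner_comm _ (partialDeriv j Y x)]
  ring

theorem partialDeriv_partialDeriv_eq_sum_christoffel_smul
    (hF : Module.finrank ℝ F = n + 1) (hY : ContDiff ℝ 2 Y)
    (hG : ∀ y, G y = Matrix.gram ℝ fun i => partialDeriv i Y y) (hdet : IsUnit (G x).det)
    (hN : ‖N‖ = 1) (hYN : ∀ i, ⟪partialDeriv i Y x, N⟫ = 0) (i j : Fin n) :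
    partialDeriv i (partialDeriv j Y) x =
      ∑ m, christoffel G m i j x • partialDeriv m Y x
        + ⟪partialDeriv i (partialDeriv j Y) x, N⟫ • N := by
  have h_indep : LinearIndependent ℝ fun i => partialDeriv i Y x := by
    rw [← Matrix.det_gram_ne_zero_iff_linearIndependent (𝕜 := ℝ), ← hG]
    exact hdet.ne_zero
  have hN0 : N ≠ 0 := norm_ne_zero_iff.1 (hN ▸ one_ne_zero)
  refine sub_eq_zero.1 (eq_zero_of_inner_eq_zero (by simpa using hF) h_indep hN0 hYN ?_ ?_)
  · intro k
    have h_tangent : ∑ m, ⟪partialDeriv k Y x, christoffel G m i j x • partialDeriv m Y x⟫ =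
        christoffelFirst G k i j x := by
      simp only [← sum_mul_christoffel hdet, hG x, Matrix.gram_apply, real_inner_smul_right,
        mul_comm]
    rw [inner_sub_right, inner_add_right, inner_sum, h_tangent, christoffelFirst_eq_inner hY hG,
      real_inner_comm, real_inner_smul_right, hYN, mul_zero, add_zero, sub_self]
  · have hNY : ∀ m, ⟪N, partialDeriv m Y x⟫ = 0 := fun m => (real_inner_comm _ _).trans (hYN m)
    simp [inner_sub_right, inner_add_right, inner_sum, real_inner_smul_right, hN, hNY,
      real_inner_comm N]

theorem inner_partialDeriv_partialDeriv (hF : Module.finrank ℝ F = n + 1) (hY : ContDiff ℝ 2 Y)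
    (hG : ∀ y, G y = Matrix.gram ℝ fun i => partialDeriv i Y y) (hdet : IsUnit (G x).det)
    (hN : ‖N‖ = 1) (hYN : ∀ i, ⟪partialDeriv i Y x, N⟫ = 0) (i j k l : Fin n) :
    ⟪partialDeriv i (partialDeriv k Y) x, partialDeriv j (partialDeriv l Y) x⟫ =
      ∑ m, christoffelFirst G m i k x * christoffel G m j l x
        + ⟪partialDeriv i (partialDeriv k Y) x, N⟫ * ⟪partialDeriv j (partialDeriv l Y) x, N⟫ := by
  conv_lhs => rw [partialDeriv_partialDeriv_eq_sum_christoffel_smul hF hY hG hdet hN hYN j l]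
  simp only [inner_add_right, inner_sum, real_inner_smul_right, christoffelFirst_eq_inner hY hG,
    mul_comm]

/-- The Gauss equation. The map `Y` being only `C^2`, its usual derivation by differentiating `Y`
three times is replaced by `partialDeriv_inner_partialDeriv_sub`. -/
theorem riemann_eq_of_gram (hF : Module.finrank ℝ F = n + 1)
    (hY : ContDiff ℝ 2 Y) (hG : ∀ y, G y = Matrix.gram ℝ fun i => partialDeriv i Y y)
    (hG2 : ∀ i j, ContDiff ℝ 2 fun y => G y i j) (hdet : ∀ y, IsUnit (G y).det)
    (hN : ‖N‖ = 1) (hYN : ∀ i, ⟪partialDeriv i Y x, N⟫ = 0) (i j k l : Fin n) :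
    riemann G i j k l x =
      ⟪partialDeriv i (partialDeriv k Y) x, N⟫ * ⟪partialDeriv j (partialDeriv l Y) x, N⟫
      - ⟪partialDeriv j (partialDeriv k Y) x, N⟫ * ⟪partialDeriv i (partialDeriv l Y) x, N⟫ := by
  have hsymm : ∀ y, (G y).IsSymm := fun y => Matrix.ext fun a b => by
    simp [hG, Matrix.gram_apply, real_inner_comm]
  have h_first : ∀ a b c, christoffelFirst G a b c =
      fun y => ⟪partialDeriv b (partialDeriv c Y) y, partialDeriv a Y y⟫ := fun a b c =>
    funext fun y => christoffelFirst_eq_inner hY hG a b c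
  have h_curl := partialDeriv_inner_partialDeriv_sub (contDiff_partialDeriv hY l)
    (differentiable_partialDeriv hY k x)
    (fun b => h_first k b l ▸ differentiableAt_christoffelFirst hG2 k b l) i j
  rw [riemann_eq_christoffelFirst hG2 hsymm hdet, h_first k j l, h_first k i l, h_curl,
    real_inner_comm, real_inner_comm (partialDeriv j (partialDeriv k Y) x),
    inner_partialDeriv_partialDeriv hF hY hG (hdet x) hN hYN i j k l,
    inner_partialDeriv_partialDeriv hF hY hG (hdet x) hN hYN j i k l]
  ring

end Hypersurface

/-! ### The algebra of the Gauss equation -/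

open scoped Matrix

/-- The Ricci tensor which the Gauss equation assigns to the first and second fundamental forms
`A` and `h`. -/
noncomputable def gaussRicci {m : Type*} [Fintype m] [DecidableEq m] (A h : Matrix m m ℝ) :
    Matrix m m ℝ :=
  (A⁻¹ * h).trace • h - h * A⁻¹ * h

/-- The sectional curvature which the Gauss equation assigns to the first and second fundamental
forms `A` and `h` and the plane spanned by the two columns of `Q`. -/
noncomputable def gaussSectional {m : Type*} [Fintype m] (A h : Matrix m m ℝ)
    (Q : Matrix m (Fin 2) ℝ) : ℝ :=
  (Qᵀ * h * Q).det / (Qᵀ * A * Q).det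

section Congruence

variable {m : Type*} [Fintype m] [DecidableEq m] {P : Matrix m m ℝ}

theorem isUnit_det_of_transpose_mul_mul_eq_one {A : Matrix m m ℝ} (h : Pᵀ * A * P = 1) :
    IsUnit P.det :=
  Matrix.isUnit_det_of_left_inverse h

theorem inv_congruence_mul_congruence (hP : IsUnit P.det) (A T : Matrix m m ℝ) :
    (Pᵀ * A * P)⁻¹ * (Pᵀ * T * P) = P⁻¹ * (A⁻¹ * T) * P := by
  have h_cancel : Pᵀ⁻¹ * Pᵀ = 1 := Matrix.nonsing_inv_mul _ (by rwa [Matrix.det_transpose])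
  calc (Pᵀ * A * P)⁻¹ * (Pᵀ * T * P) = P⁻¹ * (A⁻¹ * (Pᵀ⁻¹ * Pᵀ) * T) * P := by
        simp only [Matrix.mul_inv_rev, Matrix.mul_assoc]
    _ = P⁻¹ * (A⁻¹ * T) * P := by rw [h_cancel, Matrix.mul_one]

theorem gaussRicci_congruence (hP : IsUnit P.det) (A h : Matrix m m ℝ) :
    gaussRicci (Pᵀ * A * P) (Pᵀ * h * P) = Pᵀ * gaussRicci A h * P := by
  have h_cancel : P * P⁻¹ = 1 := Matrix.mul_nonsing_inv _ hP
  have h_trace : (P⁻¹ * (A⁻¹ * h) * P).trace = (A⁻¹ * h).trace := by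
    rw [Matrix.trace_mul_comm, ← Matrix.mul_assoc, h_cancel, Matrix.one_mul]
  have h_quad : Pᵀ * h * P * (P⁻¹ * (A⁻¹ * h) * P) = Pᵀ * (h * A⁻¹ * h) * P := by
    calc _ = Pᵀ * (h * (P * P⁻¹) * A⁻¹ * h) * P := by simp only [Matrix.mul_assoc]
      _ = _ := by rw [h_cancel, Matrix.mul_one]
  rw [gaussRicci, gaussRicci, Matrix.mul_assoc _ (Pᵀ * A * P)⁻¹,
    inv_congruence_mul_congruence hP, h_trace, h_quad]
  simp only [Matrix.mul_sub, Matrix.sub_mul, Matrix.mul_smul, Matrix.smul_mul]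

theorem tensorNorm_eq_sqrt_trace {n : ℕ} (A T : Matrix (Fin n) (Fin n) ℝ) :
    tensorNorm A T = √((A⁻¹ * T) * (Aᵀ⁻¹ * Tᵀ)).trace := by
  rw [tensorNorm]
  congr 1
  simp only [← Matrix.transpose_nonsing_inv, ← Matrix.mul_assoc, Matrix.trace, Matrix.diag_apply,
    Matrix.mul_apply, Matrix.transpose_apply, Finset.sum_mul]
  refine Finset.sum_congr rfl fun i _ => Finset.sum_congr rfl fun j _ => ?_
  rw [Finset.sum_comm]
  exact Finset.sum_congr rfl fun l _ => Finset.sum_congr rfl fun k _ => by ring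

theorem tensorNorm_congruence {n : ℕ} {P : Matrix (Fin n) (Fin n) ℝ} (hP : IsUnit P.det)
    (A T : Matrix (Fin n) (Fin n) ℝ) :
    tensorNorm (Pᵀ * A * P) (Pᵀ * T * P) = tensorNorm A T := by
  have h_transpose : ∀ B : Matrix (Fin n) (Fin n) ℝ, (Pᵀ * B * P)ᵀ = Pᵀ * Bᵀ * P := fun B => by
    simp only [Matrix.transpose_mul, Matrix.transpose_transpose, Matrix.mul_assoc]
  have h_cancel : P * P⁻¹ = 1 := Matrix.mul_nonsing_inv _ hP
  rw [tensorNorm_eq_sqrt_trace, tensorNorm_eq_sqrt_trace, h_transpose, h_transpose,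
    inv_congruence_mul_congruence hP, inv_congruence_mul_congruence hP]
  congr 1
  calc (P⁻¹ * (A⁻¹ * T) * P * (P⁻¹ * (Aᵀ⁻¹ * Tᵀ) * P)).trace
      = (P⁻¹ * (A⁻¹ * T * (P * P⁻¹) * (Aᵀ⁻¹ * Tᵀ) * P)).trace := by simp only [Matrix.mul_assoc]
    _ = (A⁻¹ * T * (Aᵀ⁻¹ * Tᵀ) * (P * P⁻¹)).trace := by
        rw [Matrix.trace_mul_comm, h_cancel, Matrix.mul_one, Matrix.mul_assoc, h_cancel]
    _ = _ := by rw [h_cancel, Matrix.mul_one]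

open scoped MatrixOrder in
theorem exists_transpose_mul_mul_eq_one {A : Matrix m m ℝ} (hA : A.PosDef) :
    ∃ P : Matrix m m ℝ, Pᵀ * A * P = 1 := by
  obtain ⟨B, hB⟩ := CStarAlgebra.nonneg_iff_eq_star_mul_self.mp hA.posSemidef.nonneg
  rw [Matrix.star_eq_conjTranspose, Matrix.conjTranspose_eq_transpose_of_trivial] at hB
  have hB_det : IsUnit B.det := isUnit_iff_ne_zero.2 fun h0 => hA.det_pos.ne' (by simp [hB, h0])
  refine ⟨B⁻¹, ?_⟩
  calc B⁻¹ᵀ * A * B⁻¹ = (B * B⁻¹)ᵀ * (B * B⁻¹) := by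
        simp only [hB, Matrix.transpose_mul, Matrix.mul_assoc]
    _ = 1 := by rw [Matrix.mul_nonsing_inv _ hB_det, Matrix.transpose_one, Matrix.one_mul]

theorem exists_transpose_mul_mul_eq_diagonal {h : Matrix m m ℝ} (hh : h.IsSymm) :
    ∃ (U : Matrix m m ℝ) (d : m → ℝ), Uᵀ * U = 1 ∧ Uᵀ * h * U = Matrix.diagonal d := by
  have h_herm : h.IsHermitian := (Matrix.conjTranspose_eq_transpose_of_trivial h).trans hh
  refine ⟨h_herm.eigenvectorUnitary, h_herm.eigenvalues, ?_, ?_⟩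
  · simpa only [Matrix.star_eq_conjTranspose, Matrix.conjTranspose_eq_transpose_of_trivial] using
      Unitary.coe_star_mul_self h_herm.eigenvectorUnitary
  · simpa [Unitary.conjStarAlgAut_star_apply, Matrix.star_eq_conjTranspose] using!
      h_herm.conjStarAlgAut_star_eigenvectorUnitary

theorem exists_simultaneous_diagonalization {A h : Matrix m m ℝ} (hA : A.PosDef)
    (hh : h.IsSymm) :
    ∃ (P : Matrix m m ℝ) (d : m → ℝ), Pᵀ * A * P = 1 ∧ Pᵀ * h * P = Matrix.diagonal d := by
  obtain ⟨Q, hQ⟩ := exists_transpose_mul_mul_eq_one hA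
  obtain ⟨U, d, hU, hUd⟩ := exists_transpose_mul_mul_eq_diagonal (h := Qᵀ * h * Q) (by
    simp only [Matrix.IsSymm, Matrix.transpose_mul, Matrix.transpose_transpose, hh.eq,
      Matrix.mul_assoc])
  have h_assoc : ∀ B : Matrix m m ℝ, (Q * U)ᵀ * B * (Q * U) = Uᵀ * (Qᵀ * B * Q) * U := fun B => by
    simp only [Matrix.transpose_mul, Matrix.mul_assoc]
  exact ⟨Q * U, d, by rw [h_assoc, hQ, Matrix.mul_one, hU], by rw [h_assoc, hUd]⟩

end Congruence

section GaussSectional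

variable {m : Type*} [Fintype m]

theorem gaussSectional_congruence (A h P : Matrix m m ℝ) (Q : Matrix m (Fin 2) ℝ) :
    gaussSectional (Pᵀ * A * P) (Pᵀ * h * P) Q = gaussSectional A h (P * Q) := by
  simp only [gaussSectional, Matrix.transpose_mul, Matrix.mul_assoc]

theorem gaussSectional_mul_right (A h : Matrix m m ℝ) (Q : Matrix m (Fin 2) ℝ)
    {R : Matrix (Fin 2) (Fin 2) ℝ} (hR : IsUnit R.det) :
    gaussSectional A h (Q * R) = gaussSectional A h Q := by
  have h_det : ∀ B : Matrix m m ℝ,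
      ((Q * R)ᵀ * B * (Q * R)).det = (Qᵀ * B * Q).det * R.det ^ 2 := fun B => by
    rw [show (Q * R)ᵀ * B * (Q * R) = Rᵀ * (Qᵀ * B * Q) * R by
      simp only [Matrix.transpose_mul, Matrix.mul_assoc], Matrix.det_mul, Matrix.det_mul,
      Matrix.det_transpose]
    ring
  rw [gaussSectional, h_det, h_det, mul_div_mul_right _ _ (pow_ne_zero 2 hR.ne_zero),
    gaussSectional]

theorem exists_mul_transpose_mul_self_eq_one {Q : Matrix m (Fin 2) ℝ}
    (hQ : Function.Injective Q.mulVec) :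
    ∃ R : Matrix (Fin 2) (Fin 2) ℝ, IsUnit R.det ∧ (Q * R)ᵀ * (Q * R) = 1 := by
  obtain ⟨R, hR⟩ := exists_transpose_mul_mul_eq_one (Matrix.PosDef.conjTranspose_mul_self Q hQ)
  refine ⟨R, isUnit_det_of_transpose_mul_mul_eq_one hR, ?_⟩
  simpa only [Matrix.conjTranspose_eq_transpose_of_trivial, Matrix.transpose_mul,
    Matrix.mul_assoc] using hR

theorem mulVec_injective_of_transpose_mul_mul_eq_one {k : Type*} [Fintype k] [DecidableEq k]
    {A : Matrix m m ℝ} {Q : Matrix m k ℝ} (hQ : Qᵀ * A * Q = 1) : Function.Injective Q.mulVec :=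
  Function.LeftInverse.injective (g := (Qᵀ * A).mulVec) fun x => by
    rw [Matrix.mulVec_mulVec, hQ, Matrix.one_mulVec]

end GaussSectional

theorem gaussRicci_one_diagonal {m : Type*} [Fintype m] [DecidableEq m] (d : m → ℝ) :
    gaussRicci 1 (Matrix.diagonal d) =
      Matrix.diagonal fun i => d i * ∑ j ∈ Finset.univ.erase i, d j := by
  have h_trace : (Matrix.diagonal d).trace = ∑ j, d j := Matrix.trace_diagonal d
  ext i j
  rcases eq_or_ne i j with rfl | hij
  · simp only [gaussRicci, inv_one, Matrix.one_mul, Matrix.mul_one, h_trace,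
      Matrix.diagonal_mul_diagonal, Matrix.sub_apply, Matrix.smul_apply, Matrix.diagonal_apply_eq,
      smul_eq_mul, ← Finset.sum_erase_add _ d (Finset.mem_univ i)]
    ring
  · simp [gaussRicci, Matrix.diagonal_mul_diagonal, hij]

theorem tensorNorm_one_diagonal {n : ℕ} (d : Fin n → ℝ) :
    tensorNorm 1 (Matrix.diagonal d) = √(∑ i, d i ^ 2) := by
  simp [tensorNorm_eq_sqrt_trace, Matrix.diagonal_mul_diagonal, sq]

theorem card_mul_card_sub_one_mul_le_sq_sum {ι : Type*} {s : Finset ι} {d : ι → ℝ} {κ : ℝ}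
    (hd : ∀ i ∈ s, ∀ j ∈ s, i ≠ j → κ ≤ d i * d j) :
    (s.card : ℝ) * ((s.card : ℝ) - 1) * κ ≤ (∑ i ∈ s, d i) ^ 2 := by
  classical
  have h_card : ((s.offDiag.card : ℕ) : ℝ) = (s.card : ℝ) * ((s.card : ℝ) - 1) := by
    rw [Finset.offDiag_card, Nat.cast_sub (Nat.le_mul_self _), Nat.cast_mul]
    ring
  calc (s.card : ℝ) * ((s.card : ℝ) - 1) * κ
      = s.offDiag.card • κ := by rw [nsmul_eq_mul, h_card]
    _ ≤ ∑ x ∈ s.offDiag, d x.1 * d x.2 := Finset.card_nsmul_le_sum _ _ _ fun x hx =>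
        have hx := Finset.mem_offDiag.1 hx
        hd _ hx.1 _ hx.2.1 hx.2.2
    _ ≤ ∑ x ∈ s.diag, d x.1 * d x.2 + ∑ x ∈ s.offDiag, d x.1 * d x.2 := by
        refine le_add_of_nonneg_left ?_
        rw [Finset.sum_diag]
        exact Finset.sum_nonneg fun i _ => mul_self_nonneg (d i)
    _ = (∑ i ∈ s, d i) ^ 2 := by
        rw [← Finset.sum_union (Finset.disjoint_diag_offDiag s), Finset.diag_union_offDiag,
          Finset.sum_product, sq, Finset.sum_mul_sum]

theorem tensorNorm_le_tensorNorm_gaussRicci {n : ℕ} {A h : Matrix (Fin n) (Fin n) ℝ}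
    (hA : A.PosDef) (hh : h.IsSymm) {κ : ℝ}
    (hκ : ∀ Q : Matrix (Fin n) (Fin 2) ℝ, Qᵀ * A * Q = 1 → κ ≤ (Qᵀ * h * Q).det) :
    √(((n : ℝ) - 1) * ((n : ℝ) - 2) * κ) * tensorNorm A h ≤ tensorNorm A (gaussRicci A h) := by
  obtain ⟨P, d, hPA, hPh⟩ := exists_simultaneous_diagonalization hA hh
  have hP : IsUnit P.det := isUnit_det_of_transpose_mul_mul_eq_one hPA
  have hd : ∀ i j, i ≠ j → κ ≤ d i * d j := fun i j hij => by
    have h_sub : ∀ B, (P.submatrix id ![i, j])ᵀ * B * P.submatrix id ![i, j] =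
        (Pᵀ * B * P).submatrix ![i, j] ![i, j] := fun B => rfl
    have h_one : (1 : Matrix (Fin n) (Fin n) ℝ).submatrix ![i, j] ![i, j] = 1 :=
      Matrix.submatrix_one _
        (by simpa [Function.Injective, Fin.forall_fin_two] using ⟨hij, hij.symm⟩)
    have h_det := hκ (P.submatrix id ![i, j]) (by rw [h_sub, hPA, h_one])
    rw [h_sub, hPh, Matrix.det_fin_two] at h_det
    simpa [hij] using h_det
  have h_sum : ∀ i, ((n : ℝ) - 1) * ((n : ℝ) - 2) * κ ≤ (∑ j ∈ Finset.univ.erase i, d j) ^ 2 :=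
    fun i => by
      have h := card_mul_card_sub_one_mul_le_sq_sum (s := Finset.univ.erase i) (κ := κ)
        fun j _ k _ hjk => hd j k hjk
      rw [Finset.card_erase_of_mem (Finset.mem_univ i), Finset.card_univ, Fintype.card_fin,
        Nat.cast_sub i.pos] at h
      convert h using 3 <;> push_cast <;> ring
  rw [← tensorNorm_congruence hP A h, ← tensorNorm_congruence hP A (gaussRicci A h),
    ← gaussRicci_congruence hP, hPA, hPh, gaussRicci_one_diagonal, tensorNorm_one_diagonal,
    tensorNorm_one_diagonal, ← Real.sqrt_mul' _ (by positivity), Finset.mul_sum]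
  refine Real.sqrt_le_sqrt (Finset.sum_le_sum fun i _ => ?_)
  rw [mul_pow, mul_comm]
  gcongr
  exact h_sum i

/-! ### Coordinates on the sphere and radial extensions -/

theorem fderiv_comp_apply_eq_mvfderiv {E E' H M F : Type*} [NormedAddCommGroup E]
    [NormedSpace ℝ E] [NormedAddCommGroup E'] [NormedSpace ℝ E'] [TopologicalSpace H]
    {I : ModelWithCorners ℝ E' H} [TopologicalSpace M] [ChartedSpace H M] [NormedAddCommGroup F]
    [NormedSpace ℝ F] {X : M → F} {f : E → M} {y : E} (hX : MDifferentiableAt I 𝓘(ℝ, F) X (f y))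
    (hf : MDifferentiableAt 𝓘(ℝ, E) I f y) (w : E) :
    fderiv ℝ (X ∘ f) y w = mvfderiv I X (f y) (mfderiv 𝓘(ℝ, E) I f y w) := by
  rw [← mfderiv_eq_fderiv, mfderiv_comp y hX hf]
  rfl

section Sphere

variable {n : ℕ}

theorem extChartAt_sphere_target (p : Sn n) : (extChartAt (𝓡 n) p).target = Set.univ := by
  have := Fact.mk (@finrank_euclideanSpace_fin ℝ _ (n + 1))
  have h : (chartAt (EuclideanSpace ℝ (Fin n)) p).target = Set.univ := stereographic'_target (-p)
  simp [h]

theorem contMDiff_extChartAt_sphere_symm (p : Sn n) (m : ℕ∞ω) :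
    ContMDiff 𝓘(ℝ, EuclideanSpace ℝ (Fin n)) (𝓡 n) m (extChartAt (𝓡 n) p).symm := by
  have : IsManifold (𝓡 n) m (Sn n) := IsManifold.of_le le_top
  rw [← contMDiffOn_univ, ← extChartAt_sphere_target p]
  exact contMDiffOn_extChartAt_symm p

theorem isInvertible_mfderiv_extChartAt_sphere_symm (p : Sn n) (x : EuclideanSpace ℝ (Fin n)) :
    (mfderiv 𝓘(ℝ, EuclideanSpace ℝ (Fin n)) (𝓡 n) (extChartAt (𝓡 n) p).symm x).IsInvertible := by
  have : IsManifold (𝓡 n) 1 (Sn n) := IsManifold.of_le (n := ω) le_top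
  have h := isInvertible_mfderivWithin_extChartAt_symm (I := 𝓡 n) (x := p) (y := x)
    (extChartAt_sphere_target p ▸ Set.mem_univ x)
  rwa [show Set.range (𝓡 n) = Set.univ by simp, mfderivWithin_univ] at h

theorem contMDiff_coe_Sn (m : ℕ∞ω) : ContMDiff (𝓡 n) 𝓘(ℝ, EuclideanSpace ℝ (Fin (n + 1))) m
    ((↑) : Sn n → EuclideanSpace ℝ (Fin (n + 1))) :=
  have := Fact.mk (@finrank_euclideanSpace_fin ℝ _ (n + 1))
  contMDiff_coe_sphere

/-- The inverse of the chart centred at `p`, as a parametrization with values in `ℝ^{n+1}`. -/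
noncomputable def sphereParam (p : Sn n) (x : EuclideanSpace ℝ (Fin n)) :
    EuclideanSpace ℝ (Fin (n + 1)) :=
  (extChartAt (𝓡 n) p).symm x

/-- The vector `v^i ∂_i` at `p`, where `∂_i` are the coordinate vectors of the chart centred
at `p`, as a vector of `ℝ^{n+1}`. -/
noncomputable def coordVector (p : Sn n) :
    EuclideanSpace ℝ (Fin n) →L[ℝ] EuclideanSpace ℝ (Fin (n + 1)) :=
  fderiv ℝ (sphereParam p) (extChartAt (𝓡 n) p p)

theorem sphereParam_extChartAt_self (p : Sn n) : sphereParam p (extChartAt (𝓡 n) p p) = p :=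
  congrArg Subtype.val (extChartAt_to_inv p)

theorem contDiff_sphereParam (p : Sn n) : ContDiff ℝ 2 (sphereParam p) :=
  ((contMDiff_coe_Sn 2).comp (contMDiff_extChartAt_sphere_symm p 2)).contDiff

theorem range_coordVector (p : Sn n) :
    Set.range (coordVector p) = {w | ⟪(p : EuclideanSpace ℝ (Fin (n + 1))), w⟫ = 0} := by
  have := Fact.mk (@finrank_euclideanSpace_fin ℝ _ (n + 1))
  have h_comp : ∀ v, coordVector p v = mvfderiv (𝓡 n) ((↑) : Sn n → EuclideanSpace ℝ (Fin (n + 1)))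
      ((extChartAt (𝓡 n) p).symm (extChartAt (𝓡 n) p p))
      (mfderiv 𝓘(ℝ, EuclideanSpace ℝ (Fin n)) (𝓡 n) (extChartAt (𝓡 n) p).symm
        (extChartAt (𝓡 n) p p) v) :=
    fderiv_comp_apply_eq_mvfderiv ((contMDiff_coe_Sn 1 _).mdifferentiableAt one_ne_zero)
      ((contMDiff_extChartAt_sphere_symm p 1 _).mdifferentiableAt one_ne_zero)
  have h_range := (range_mvfderiv_subtypeVal (n := n)
    ((extChartAt (𝓡 n) p).symm (extChartAt (𝓡 n) p p))).trans
      (congrArg (fun q : Sn n => (ℝ ∙ (q : EuclideanSpace ℝ (Fin (n + 1))))ᗮ) (extChartAt_to_inv p))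
  have h_surj := (isInvertible_mfderiv_extChartAt_sphere_symm p (extChartAt (𝓡 n) p p)).surjective
  ext w
  rw [Set.mem_ofPred_eq, ← Submodule.mem_orthogonal_singleton_iff_inner_right, ← h_range]
  refine ⟨?_, ?_⟩
  · rintro ⟨v, rfl⟩
    exact ⟨_, (h_comp v).symm⟩
  · rintro ⟨u, rfl⟩
    obtain ⟨v, rfl⟩ := h_surj u
    exact ⟨v, h_comp v⟩

/-- Radial retraction of `ℝ^{n+1}` onto the sphere, with an arbitrary value at the origin. It is
used to extend maps from the sphere to `ℝ^{n+1}`, so that their derivatives at different points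
can be compared without charts. -/
noncomputable def radialRetraction (y : EuclideanSpace ℝ (Fin (n + 1))) : Sn n :=
  if h : y = 0 then ⟨EuclideanSpace.single 0 1, by simp⟩
  else ⟨‖y‖⁻¹ • y, by simp [norm_smul, h]⟩

theorem radialRetraction_coe (p : Sn n) :
    radialRetraction (p : EuclideanSpace ℝ (Fin (n + 1))) = p := by
  have h : (p : EuclideanSpace ℝ (Fin (n + 1))) ≠ 0 := ne_zero_of_mem_unit_sphere p
  ext1
  simp [radialRetraction, h]

theorem contMDiffAt_radialRetraction {y : EuclideanSpace ℝ (Fin (n + 1))} (hy : y ≠ 0)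
    (m : ℕ∞ω) :
    ContMDiffAt 𝓘(ℝ, EuclideanSpace ℝ (Fin (n + 1))) (𝓡 n) m radialRetraction y := by
  have := Fact.mk (@finrank_euclideanSpace_fin ℝ _ (n + 1))
  let U : TopologicalSpace.Opens (EuclideanSpace ℝ (Fin (n + 1))) := ⟨{y | y ≠ 0}, isOpen_ne⟩
  have h : ContMDiff 𝓘(ℝ, EuclideanSpace ℝ (Fin (n + 1))) 𝓘(ℝ, EuclideanSpace ℝ (Fin (n + 1))) m
      fun z : U => ‖z.1‖⁻¹ • z.1 := fun z =>
    contMDiffAt_subtype_iff (f := fun z : EuclideanSpace ℝ (Fin (n + 1)) => ‖z‖⁻¹ • z).2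
      (((contDiffAt_norm ℝ z.2).inv (norm_ne_zero_iff.2 z.2)).smul contDiffAt_id).contMDiffAt
  have h_sphere := h.codRestrict_sphere (n := n) fun z => by
    simp [norm_smul, show (z : EuclideanSpace ℝ (Fin (n + 1))) ≠ 0 from z.2]
  refine (contMDiffAt_subtype_iff (x := (⟨y, hy⟩ : U))).1
    ((h_sphere ⟨y, hy⟩).congr_of_eventuallyEq ?_)
  exact .of_forall fun z => dif_neg z.2

end Sphere

section RadialExtension

variable {n : ℕ} {F : Type*} [NormedAddCommGroup F] [NormedSpace ℝ F] {X : Sn n → F}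

theorem contDiffAt_comp_radialRetraction (hX : ContMDiff (𝓡 n) 𝓘(ℝ, F) 2 X) (p : Sn n) :
    ContDiffAt ℝ 2 (X ∘ radialRetraction) (p : EuclideanSpace ℝ (Fin (n + 1))) :=
  ((hX _).comp _ (contMDiffAt_radialRetraction (ne_zero_of_mem_unit_sphere p) 2)).contDiffAt

theorem contDiff_comp_extChartAt_symm (hX : ContMDiff (𝓡 n) 𝓘(ℝ, F) 2 X) (p : Sn n) :
    ContDiff ℝ 2 (X ∘ (extChartAt (𝓡 n) p).symm) :=
  (hX.comp (contMDiff_extChartAt_sphere_symm p 2)).contDiff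

theorem comp_radialRetraction_comp_coe {F : Type*} (X : Sn n → F) :
    (X ∘ radialRetraction) ∘ ((↑) : Sn n → EuclideanSpace ℝ (Fin (n + 1))) = X :=
  funext fun p => congrArg X (radialRetraction_coe p)

theorem comp_radialRetraction_comp_sphereParam {F : Type*} (X : Sn n → F) (p : Sn n) :
    (X ∘ radialRetraction) ∘ sphereParam p = X ∘ (extChartAt (𝓡 n) p).symm :=
  funext fun _ => congrArg X (radialRetraction_coe _)

theorem fderiv_comp_extChartAt_symm (hX : ContMDiff (𝓡 n) 𝓘(ℝ, F) 2 X) (p : Sn n)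
    (x : EuclideanSpace ℝ (Fin n)) : fderiv ℝ (X ∘ (extChartAt (𝓡 n) p).symm) x =
      fderiv ℝ (X ∘ radialRetraction) (sphereParam p x) ∘L fderiv ℝ (sphereParam p) x := by
  rw [← comp_radialRetraction_comp_sphereParam]
  exact fderiv_comp x ((contDiffAt_comp_radialRetraction hX _).differentiableAt two_ne_zero)
    ((contDiff_sphereParam p).differentiable two_ne_zero x)

theorem fderiv_comp_extChartAt_symm_self (hX : ContMDiff (𝓡 n) 𝓘(ℝ, F) 2 X) (p : Sn n)
    (v : EuclideanSpace ℝ (Fin n)) :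
    fderiv ℝ (X ∘ (extChartAt (𝓡 n) p).symm) (extChartAt (𝓡 n) p p) v =
      fderiv ℝ (X ∘ radialRetraction) p (coordVector p v) := by
  rw [fderiv_comp_extChartAt_symm hX, sphereParam_extChartAt_self]
  rfl

theorem inner_fderiv_fderiv_comp_extChartAt_symm {F : Type*} [NormedAddCommGroup F]
    [InnerProductSpace ℝ F] {X : Sn n → F} (hX : ContMDiff (𝓡 n) 𝓘(ℝ, F) 2 X) (p : Sn n) {N : F}
    (hN : ∀ w, ⟪fderiv ℝ (X ∘ radialRetraction) p w, N⟫ = 0)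
    (u v : EuclideanSpace ℝ (Fin n)) :
    ⟪fderiv ℝ (fderiv ℝ (X ∘ (extChartAt (𝓡 n) p).symm)) (extChartAt (𝓡 n) p p) u v, N⟫ =
      ⟪fderiv ℝ (fderiv ℝ (X ∘ radialRetraction)) p (coordVector p u) (coordVector p v), N⟫ := by
  set x₀ := extChartAt (𝓡 n) p p
  have h_ext : HasFDerivAt (fderiv ℝ (X ∘ radialRetraction))
      (fderiv ℝ (fderiv ℝ (X ∘ radialRetraction)) p) (sphereParam p x₀) := by
    rw [sphereParam_extChartAt_self]
    exact (((contDiffAt_comp_radialRetraction hX p).fderiv_right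
      (m := 1) (by norm_num)).differentiableAt one_ne_zero).hasFDerivAt
  have h_param : HasFDerivAt (sphereParam p) (coordVector p) x₀ :=
    ((contDiff_sphereParam p).differentiable two_ne_zero x₀).hasFDerivAt
  have h_param₂ : HasFDerivAt (fderiv ℝ (sphereParam p)) (fderiv ℝ (fderiv ℝ (sphereParam p)) x₀)
      x₀ :=
    (((contDiff_sphereParam p).fderiv_right
      (m := 1) (by norm_num)).differentiable one_ne_zero x₀).hasFDerivAt
  have h_normal := hN (fderiv ℝ (fderiv ℝ (sphereParam p)) x₀ u v)
  rw [← sphereParam_extChartAt_self p] at h_normal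
  have h_eq : fderiv ℝ (X ∘ (extChartAt (𝓡 n) p).symm) = fun x =>
      (fderiv ℝ (X ∘ radialRetraction) ∘ sphereParam p) x ∘L fderiv ℝ (sphereParam p) x :=
    funext (fderiv_comp_extChartAt_symm hX p)
  rw [h_eq, ((h_ext.comp x₀ h_param).clm_comp h_param₂).fderiv]
  simp only [add_apply, inner_add_left]
  exact (congrArg (· + _) h_normal).trans (zero_add _)

theorem range_fderiv_comp_radialRetraction (hX : ContMDiff (𝓡 n) 𝓘(ℝ, F) 2 X) (p : Sn n) :
    Set.range (fderiv ℝ (X ∘ radialRetraction) (p : EuclideanSpace ℝ (Fin (n + 1)))) =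
      Set.range (mvfderiv (𝓡 n) X p) := by
  have hp : (p : EuclideanSpace ℝ (Fin (n + 1))) ≠ 0 := ne_zero_of_mem_unit_sphere p
  have h_ext := (contDiffAt_comp_radialRetraction hX p).differentiableAt two_ne_zero
  refine subset_antisymm ?_ ?_
  · rintro _ ⟨w, rfl⟩
    rw [fderiv_comp_apply_eq_mvfderiv ((hX _).mdifferentiableAt two_ne_zero)
      ((contMDiffAt_radialRetraction hp 1).mdifferentiableAt one_ne_zero), radialRetraction_coe]
    exact ⟨_, rfl⟩
  · rintro _ ⟨u, rfl⟩
    refine ⟨mvfderiv (𝓡 n) ((↑) : Sn n → EuclideanSpace ℝ (Fin (n + 1))) p u, ?_⟩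
    have h := mfderiv_comp_apply p h_ext.mdifferentiableAt
      ((contMDiff_coe_Sn 1 p).mdifferentiableAt one_ne_zero) u
    rw [comp_radialRetraction_comp_coe, mfderiv_eq_fderiv] at h
    exact h.symm

theorem isUnitNormal_iff {X : Sn n → EuclideanSpace ℝ (Fin (n + 1))}
    (hX : ContMDiff (𝓡 n) 𝓘(ℝ, EuclideanSpace ℝ (Fin (n + 1))) 2 X) {p : Sn n}
    {N : EuclideanSpace ℝ (Fin (n + 1))} :
    IsUnitNormal X p N ↔ ‖N‖ = 1 ∧ ∀ w, ⟪fderiv ℝ (X ∘ radialRetraction) p w, N⟫ = 0 := by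
  rw [← Set.forall_mem_range (p := fun y => ⟪y, N⟫ = 0), range_fderiv_comp_radialRetraction hX,
    Set.forall_mem_range]
  exact ⟨fun h => ⟨h.1, h.2⟩, fun h => ⟨h.1, h.2⟩⟩

theorem exists_isUnitNormal (X : Sn n → EuclideanSpace ℝ (Fin (n + 1))) (p : Sn n) :
    ∃ N, IsUnitNormal X p N := by
  let L : EuclideanSpace ℝ (Fin n) →L[ℝ] EuclideanSpace ℝ (Fin (n + 1)) := mvfderiv (𝓡 n) X p
  have h_ne_top : L.range ≠ ⊤ := fun h => by
    have h_le := L.toLinearMap.finrank_range_le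
    rw [h, finrank_top, finrank_euclideanSpace_fin, finrank_euclideanSpace_fin] at h_le
    exact n.lt_irrefl h_le
  obtain ⟨w, hw, hw0⟩ := Submodule.exists_mem_ne_zero_of_ne_bot
    (mt Submodule.orthogonal_eq_bot_iff.1 h_ne_top)
  refine ⟨‖w‖⁻¹ • w, by simp [norm_smul, hw0], fun u => ?_⟩
  have hu : ⟪mvfderiv (𝓡 n) X p u, w⟫ = 0 := hw _ ⟨u, rfl⟩
  rw [inner_smul_right, hu, mul_zero]

end RadialExtension

/-! ### The Gauss equation on the sphere -/

section ChartMetric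

theorem contMDiff_mfderiv_apply_const {E E' H M : Type*} [NormedAddCommGroup E] [NormedSpace ℝ E]
    [NormedAddCommGroup E'] [NormedSpace ℝ E'] [TopologicalSpace H] {I : ModelWithCorners ℝ E' H}
    [TopologicalSpace M] [ChartedSpace H M] [IsManifold I 1 M] {f : E → M} {m k : ℕ∞ω}
    (hf : ContMDiff 𝓘(ℝ, E) I k f) (hmk : m + 1 ≤ k) (v : E) :
    ContMDiff 𝓘(ℝ, E) (I.prod 𝓘(ℝ, E')) m
      fun x => (Bundle.TotalSpace.mk' E' (f x) (mfderiv 𝓘(ℝ, E) I f x v) : TangentBundle I M) := by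
  have h_const : ContMDiff 𝓘(ℝ, E) (𝓘(ℝ, E).prod 𝓘(ℝ, E)) m
      fun x => (Bundle.TotalSpace.mk' E x v : TangentBundle 𝓘(ℝ, E) E) :=
    contMDiff_vectorSpace_iff_contDiff.2 contDiff_const
  exact (hf.contMDiff_tangentMap hmk).comp h_const

variable {n : ℕ}

theorem contDiff_chartMetric (g : C2Metric n) (p : Sn n) (i j : Fin n) :
    ContDiff ℝ 2 fun x => chartMetric g p x i j := by
  have h_symm := contMDiff_extChartAt_sphere_symm p 3
  have h_vec : ∀ i : Fin n, ContMDiff 𝓘(ℝ, EuclideanSpace ℝ (Fin n))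
      ((𝓡 n).prod 𝓘(ℝ, EuclideanSpace ℝ (Fin n))) 2
      fun x => (Bundle.TotalSpace.mk' (EuclideanSpace ℝ (Fin n)) ((extChartAt (𝓡 n) p).symm x)
        (mfderiv 𝓘(ℝ, EuclideanSpace ℝ (Fin n)) (𝓡 n) (extChartAt (𝓡 n) p).symm x
          (EuclideanSpace.single i (1 : ℝ))) : TangentBundle (𝓡 n) (Sn n)) := fun i =>
    contMDiff_mfderiv_apply_const h_symm (by norm_num) _
  have h : ContMDiff 𝓘(ℝ, EuclideanSpace ℝ (Fin n)) ((𝓡 n).prod 𝓘(ℝ)) 2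
      (fun x => Bundle.TotalSpace.mk' ℝ (E := Bundle.Trivial (Sn n) ℝ)
        ((extChartAt (𝓡 n) p).symm x) (chartMetric g p x i j)) :=
    ContMDiff.clm_bundle_apply₂ (F₁ := EuclideanSpace ℝ (Fin n))
      (F₂ := EuclideanSpace ℝ (Fin n)) (E₁ := fun p : Sn n => TangentSpace (𝓡 n) p)
      (E₂ := fun p : Sn n => TangentSpace (𝓡 n) p)
      (g.contMDiff.comp (h_symm.of_le (by norm_num))) (h_vec i) (h_vec j)
  exact contMDiff_iff_contDiff.1 fun x => (Bundle.contMDiffAt_totalSpace.1 (h x)).2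

theorem bilin_eq_dotProduct_mulVec
    (B : EuclideanSpace ℝ (Fin n) →ₗ[ℝ] EuclideanSpace ℝ (Fin n) →ₗ[ℝ] ℝ)
    (u v : EuclideanSpace ℝ (Fin n)) :
    B u v = u.ofLp ⬝ᵥ Matrix.of (fun i j => B (EuclideanSpace.single i 1)
      (EuclideanSpace.single j 1)) *ᵥ v.ofLp := by
  rw [← LinearMap.sum_repr_mul_repr_mul (EuclideanSpace.basisFun (Fin n) ℝ).toBasis
    (EuclideanSpace.basisFun (Fin n) ℝ).toBasis, Finsupp.sum_fintype _ _ (by simp)]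
  simp only [Finsupp.sum_fintype, OrthonormalBasis.coe_toBasis, EuclideanSpace.basisFun_apply,
    OrthonormalBasis.coe_toBasis_repr_apply, EuclideanSpace.basisFun_repr, smul_eq_mul, zero_mul,
    mul_zero, implies_true, dotProduct, Matrix.mulVec, Matrix.of_apply, Finset.mul_sum]
  exact Finset.sum_congr rfl fun i _ => Finset.sum_congr rfl fun j _ => by ring

theorem posDef_chartMetric (g : C2Metric n) (p : Sn n) (x : EuclideanSpace ℝ (Fin n)) :
    (chartMetric g p x).PosDef := by
  let D : EuclideanSpace ℝ (Fin n) →L[ℝ] EuclideanSpace ℝ (Fin n) :=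
    mfderiv 𝓘(ℝ, EuclideanSpace ℝ (Fin n)) (𝓡 n) (extChartAt (𝓡 n) p).symm x
  let b : EuclideanSpace ℝ (Fin n) →L[ℝ] EuclideanSpace ℝ (Fin n) →L[ℝ] ℝ :=
    g.inner ((extChartAt (𝓡 n) p).symm x)
  refine .of_dotProduct_mulVec_pos (Matrix.IsSymm.ext fun i j => g.symm _ _ _) fun u hu => ?_
  have hD : Function.Injective D := (isInvertible_mfderiv_extChartAt_sphere_symm p x).injective
  have hDu : D (WithLp.toLp 2 u) ≠ 0 :=
    (map_ne_zero_iff D hD).2 ((WithLp.toLp_eq_zero 2).not.2 hu)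
  have h := g.pos ((extChartAt (𝓡 n) p).symm x) _ hDu
  have h_bilin := bilin_eq_dotProduct_mulVec ((b.bilinearComp D D).toLinearMap₁₂)
    (WithLp.toLp 2 u) (WithLp.toLp 2 u)
  exact h.trans_eq h_bilin

/-- `X` is a `C^2` isometric immersion `(S^n, g) → ℝ^{n+1}`: a `C^2` map that pulls the Euclidean
inner product back to `g`. -/
structure IsC2IsometricImmersion (g : C2Metric n) (X : Sn n → EuclideanSpace ℝ (Fin (n + 1))) :
    Prop where
  contMDiff : ContMDiff (𝓡 n) 𝓘(ℝ, EuclideanSpace ℝ (Fin (n + 1))) 2 X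
  isometric : ∀ (p : Sn n) (u v : TangentSpace (𝓡 n) p),
    ⟪mvfderiv (𝓡 n) X p u, mvfderiv (𝓡 n) X p v⟫ = g.inner p u v

variable {g : C2Metric n} {X : Sn n → EuclideanSpace ℝ (Fin (n + 1))}

theorem IsC2IsometricEmbedding.isC2IsometricImmersion (hX : IsC2IsometricEmbedding g X) :
    IsC2IsometricImmersion g X :=
  ⟨hX.contMDiff, hX.isometric⟩

theorem chartMetric_eq_gram (hX : IsC2IsometricImmersion g X) (p : Sn n)
    (x : EuclideanSpace ℝ (Fin n)) : chartMetric g p x =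
      Matrix.gram ℝ fun i => partialDeriv i (X ∘ (extChartAt (𝓡 n) p).symm) x := by
  have h_deriv : ∀ i, partialDeriv i (X ∘ (extChartAt (𝓡 n) p).symm) x = _ := fun i =>
    fderiv_comp_apply_eq_mvfderiv ((hX.contMDiff _).mdifferentiableAt two_ne_zero)
      ((contMDiff_extChartAt_sphere_symm p 1 x).mdifferentiableAt one_ne_zero) _
  ext i j
  rw [Matrix.gram_apply, h_deriv, h_deriv, hX.isometric]
  rfl

theorem isSymm_secondFundamentalForm
    (hX : ContMDiff (𝓡 n) 𝓘(ℝ, EuclideanSpace ℝ (Fin (n + 1))) 2 X) (p : Sn n)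
    (N : EuclideanSpace ℝ (Fin (n + 1))) : (secondFundamentalForm X p N).IsSymm := by
  have h_diff := contDiff_comp_extChartAt_symm hX p
  refine Matrix.IsSymm.ext fun i j => ?_
  rw [secondFundamentalForm, secondFundamentalForm,
    partialDeriv_comm (h_diff.differentiable two_ne_zero)
      fun j => differentiable_partialDeriv h_diff j _]

variable {p : Sn n} {N : EuclideanSpace ℝ (Fin (n + 1))}

theorem riemann_chartMetric (hX : IsC2IsometricImmersion g X) (hN : IsUnitNormal X p N)
    (i j k l : Fin n) :
    riemann (chartMetric g p) i j k l (extChartAt (𝓡 n) p p) =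
      secondFundamentalForm X p N i k * secondFundamentalForm X p N j l
        - secondFundamentalForm X p N j k * secondFundamentalForm X p N i l := by
  have h_normal : ∀ i, ⟪partialDeriv i (X ∘ (extChartAt (𝓡 n) p).symm) (extChartAt (𝓡 n) p p), N⟫
      = 0 := fun i => by
    rw [partialDeriv, fderiv_comp_extChartAt_symm_self hX.contMDiff]
    exact ((isUnitNormal_iff hX.contMDiff).1 hN).2 _
  rw [riemann_eq_of_gram finrank_euclideanSpace_fin (contDiff_comp_extChartAt_symm hX.contMDiff p)
    (chartMetric_eq_gram hX p) (contDiff_chartMetric g p)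
    (fun x => (posDef_chartMetric g p x).det_pos.ne'.isUnit) hN.norm_eq_one h_normal]
  simp only [secondFundamentalForm, neg_mul_neg]

theorem ricci_chartMetric (hX : IsC2IsometricImmersion g X) (hN : IsUnitNormal X p N) :
    ricci (chartMetric g p) (extChartAt (𝓡 n) p p) =
      gaussRicci (chartMetric g p (extChartAt (𝓡 n) p p)) (secondFundamentalForm X p N) := by
  ext j l
  simp only [ricci, riemann_chartMetric hX hN]
  have hχ := isSymm_secondFundamentalForm hX.contMDiff p N
  have hA := (posDef_chartMetric g p (extChartAt (𝓡 n) p p)).inv.isHermitian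
  generalize secondFundamentalForm X p N = h at hχ ⊢
  generalize (chartMetric g p (extChartAt (𝓡 n) p p)) = A at hA ⊢
  simp only [gaussRicci, Matrix.sub_apply, Matrix.smul_apply, smul_eq_mul, Matrix.trace,
    Matrix.diag_apply, Matrix.mul_apply, mul_sub, Finset.sum_sub_distrib,
    Finset.sum_mul]
  congr 1 <;> refine Finset.sum_congr rfl fun i _ => Finset.sum_congr rfl fun k _ => ?_
  · rw [hχ.apply k i, mul_assoc]
  · rw [← hA.apply i k, star_trivial]
    ring

theorem det_of_transpose_mul_mul_of_transpose {m : Type*} [Fintype m] (B : Matrix m m ℝ)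
    (u v : m → ℝ) :
    ((Matrix.of ![u, v])ᵀᵀ * B * (Matrix.of ![u, v])ᵀ).det =
      (u ⬝ᵥ B *ᵥ u) * (v ⬝ᵥ B *ᵥ v) - (u ⬝ᵥ B *ᵥ v) * (v ⬝ᵥ B *ᵥ u) := by
  have h_entry : ∀ a b, ((Matrix.of ![u, v])ᵀᵀ * B * (Matrix.of ![u, v])ᵀ) a b =
      ![u, v] a ⬝ᵥ B *ᵥ ![u, v] b := fun a b => by
    rw [Matrix.mul_assoc]
    rfl
  simp only [Matrix.det_fin_two, h_entry, Matrix.cons_val_zero, Matrix.cons_val_one]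

theorem sum_gauss_mul_eq {m : Type*} [Fintype m] (h : Matrix m m ℝ) (u v : m → ℝ) :
    ∑ i, ∑ j, ∑ k, ∑ l, (h i k * h j l - h j k * h i l) * u i * v j * u k * v l =
      (u ⬝ᵥ h *ᵥ u) * (v ⬝ᵥ h *ᵥ v) - (u ⬝ᵥ h *ᵥ v) * (v ⬝ᵥ h *ᵥ u) := by
  have h_prod : ∀ f g : m → m → ℝ,
      (∑ i, ∑ k, f i k) * ∑ j, ∑ l, g j l = ∑ i, ∑ j, ∑ k, ∑ l, f i k * g j l := fun f g => by
    simp only [Finset.sum_mul_sum]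
  have h_prod_comm : ∀ f g : m → m → ℝ,
      (∑ i, ∑ l, f i l) * ∑ j, ∑ k, g j k = ∑ i, ∑ j, ∑ k, ∑ l, f i l * g j k := fun f g => by
    rw [h_prod]
    exact Finset.sum_congr rfl fun i _ => Finset.sum_congr rfl fun j _ => Finset.sum_comm
  have h_bilin : ∀ a b : m → ℝ, a ⬝ᵥ h *ᵥ b = ∑ i, ∑ j, a i * (h i j * b j) := fun a b => by
    simp only [dotProduct, Matrix.mulVec, Finset.mul_sum]
  rw [h_bilin, h_bilin, h_bilin, h_bilin, h_prod, h_prod_comm]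
  simp only [← Finset.sum_sub_distrib]
  refine Finset.sum_congr rfl fun i _ => Finset.sum_congr rfl fun j _ =>
    Finset.sum_congr rfl fun k _ => Finset.sum_congr rfl fun l _ => ?_
  ring

theorem sectional_chartMetric (hX : IsC2IsometricImmersion g X) (hN : IsUnitNormal X p N)
    (u v : Fin n → ℝ) :
    sectional (chartMetric g p) (extChartAt (𝓡 n) p p) u v =
      gaussSectional (chartMetric g p (extChartAt (𝓡 n) p p)) (secondFundamentalForm X p N)
        (Matrix.of ![u, v])ᵀ := by
  have hA := (posDef_chartMetric g p (extChartAt (𝓡 n) p p)).isHermitian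
  have h_symm : ∀ B : Matrix (Fin n) (Fin n) ℝ, B.IsSymm → v ⬝ᵥ B *ᵥ u = u ⬝ᵥ B *ᵥ v :=
    fun B hB => by rw [Matrix.dotProduct_mulVec, ← Matrix.mulVec_transpose, hB.eq, dotProduct_comm]
  simp only [sectional, gaussSectional, riemann_chartMetric hX hN, sum_gauss_mul_eq,
    det_of_transpose_mul_mul_of_transpose, h_symm _ (Matrix.isHermitian_iff_isSymm.1 hA), sq]

end ChartMetric

/-! ### Attainment of the extreme curvatures -/

section Frames

variable {n : ℕ}

theorem continuous_fderiv_comp_radialRetraction {F : Type*} [NormedAddCommGroup F]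
    [NormedSpace ℝ F] {X : Sn n → F} (hX : ContMDiff (𝓡 n) 𝓘(ℝ, F) 2 X) :
    Continuous fun p : Sn n =>
      fderiv ℝ (X ∘ radialRetraction) (p : EuclideanSpace ℝ (Fin (n + 1))) :=
  continuous_iff_continuousAt.2 fun p =>
    ((contDiffAt_comp_radialRetraction hX p).fderiv_right
      (m := 1) (by norm_num)).continuousAt.comp continuous_subtype_val.continuousAt

theorem continuous_fderiv_fderiv_comp_radialRetraction {F : Type*} [NormedAddCommGroup F]
    [NormedSpace ℝ F] {X : Sn n → F} (hX : ContMDiff (𝓡 n) 𝓘(ℝ, F) 2 X) :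
    Continuous fun p : Sn n =>
      fderiv ℝ (fderiv ℝ (X ∘ radialRetraction)) (p : EuclideanSpace ℝ (Fin (n + 1))) :=
  continuous_iff_continuousAt.2 fun p =>
    (((contDiffAt_comp_radialRetraction hX p).fderiv_right (m := 1) (by norm_num)).fderiv_right
      (m := 0) (by norm_num)).continuousAt.comp continuous_subtype_val.continuousAt

/-- A point `p`, a unit normal `N` of `X` at `p` and a Euclidean orthonormal basis `e` of the
tangent space of the sphere at `p`. The vectors are encoded as points of the sphere, so that the
set of such triples is compact. -/
def adaptedFrames (X : Sn n → EuclideanSpace ℝ (Fin (n + 1))) :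
    Set (Sn n × Sn n × (Fin n → Sn n)) :=
  {t | IsUnitNormal X t.1 t.2.1 ∧
    Orthonormal ℝ (fun i => (t.2.2 i : EuclideanSpace ℝ (Fin (n + 1)))) ∧
    ∀ i, ⟪(t.1 : EuclideanSpace ℝ (Fin (n + 1))), t.2.2 i⟫ = 0}

/-- The matrices of the first and second fundamental forms of `X` in the frame `t`, computed with
the radial extension of `X`. -/
noncomputable def frameForms (X : Sn n → EuclideanSpace ℝ (Fin (n + 1)))
    (t : Sn n × Sn n × (Fin n → Sn n)) : Matrix (Fin n) (Fin n) ℝ × Matrix (Fin n) (Fin n) ℝ :=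
  (Matrix.of fun i j => ⟪fderiv ℝ (X ∘ radialRetraction) t.1 (t.2.2 i),
      fderiv ℝ (X ∘ radialRetraction) t.1 (t.2.2 j)⟫,
    Matrix.of fun i j =>
      -⟪fderiv ℝ (fderiv ℝ (X ∘ radialRetraction)) t.1 (t.2.2 i) (t.2.2 j), t.2.1⟫)

variable {X : Sn n → EuclideanSpace ℝ (Fin (n + 1))}

theorem isCompact_adaptedFrames
    (hX : ContMDiff (𝓡 n) 𝓘(ℝ, EuclideanSpace ℝ (Fin (n + 1))) 2 X) :
    IsCompact (adaptedFrames X) := by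
  have h_fderiv := (continuous_fderiv_comp_radialRetraction hX).comp
    (continuous_fst (Y := Sn n × (Fin n → Sn n)))
  have h_eq : adaptedFrames X = {t | (∀ w, ⟪fderiv ℝ (X ∘ radialRetraction) t.1 w, t.2.1⟫ = 0) ∧
      (∀ i j, ⟪(t.2.2 i : EuclideanSpace ℝ (Fin (n + 1))), t.2.2 j⟫ = if i = j then 1 else 0) ∧
      ∀ i, ⟪(t.1 : EuclideanSpace ℝ (Fin (n + 1))), t.2.2 i⟫ = 0} := by
    ext t
    simp only [adaptedFrames, isUnitNormal_iff hX, norm_eq_of_mem_sphere, true_and,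
      orthonormal_iff_ite]
  rw [h_eq]
  simp only [Set.ofPred_and, Set.ofPred_forall]
  refine IsClosed.isCompact (.inter (isClosed_iInter fun w => ?_) (.inter
    (isClosed_iInter fun i => isClosed_iInter fun j => ?_) (isClosed_iInter fun i => ?_)))
  · exact isClosed_eq ((h_fderiv.clm_apply continuous_const).inner (by fun_prop)) continuous_const
  · exact isClosed_eq (by fun_prop) continuous_const
  · exact isClosed_eq (by fun_prop) continuous_const

theorem continuous_frameForms
    (hX : ContMDiff (𝓡 n) 𝓘(ℝ, EuclideanSpace ℝ (Fin (n + 1))) 2 X) :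
    Continuous (frameForms X) := by
  have h_fderiv := (continuous_fderiv_comp_radialRetraction hX).comp
    (continuous_fst (Y := Sn n × (Fin n → Sn n)))
  have h_fderiv₂ := (continuous_fderiv_fderiv_comp_radialRetraction hX).comp
    (continuous_fst (Y := Sn n × (Fin n → Sn n)))
  have h_frame : ∀ i, Continuous fun t : Sn n × Sn n × (Fin n → Sn n) =>
      (t.2.2 i : EuclideanSpace ℝ (Fin (n + 1))) := fun i => by fun_prop
  refine .prodMk (continuous_matrix fun i j => ?_) (continuous_matrix fun i j => ?_)
  · exact (h_fderiv.clm_apply (h_frame i)).inner (h_fderiv.clm_apply (h_frame j))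
  · exact (((h_fderiv₂.clm_apply (h_frame i)).clm_apply (h_frame j)).inner (by fun_prop)).neg

theorem exists_orthonormal_inner_eq_zero (p : Sn n) :
    ∃ e : Fin n → Sn n, Orthonormal ℝ (fun i => (e i : EuclideanSpace ℝ (Fin (n + 1)))) ∧
      ∀ i, ⟪(p : EuclideanSpace ℝ (Fin (n + 1))), e i⟫ = 0 := by
  have := Fact.mk (@finrank_euclideanSpace_fin ℝ _ (n + 1))
  have h_finrank := Submodule.finrank_orthogonal_span_singleton (𝕜 := ℝ) (n := n)
    (ne_zero_of_mem_unit_sphere p)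
  let b := (stdOrthonormalBasis ℝ (ℝ ∙ (p : EuclideanSpace ℝ (Fin (n + 1))))ᗮ).reindex
    (finCongr h_finrank)
  refine ⟨fun i => ⟨b i, mem_sphere_zero_iff_norm.2 (b.orthonormal.1 i)⟩,
    b.orthonormal.comp_linearIsometry (Submodule.subtypeₗᵢ _), fun i => ?_⟩
  exact Submodule.mem_orthogonal_singleton_iff_inner_right.1 (b i).2

theorem exists_mem_adaptedFrames {p : Sn n} {N : EuclideanSpace ℝ (Fin (n + 1))}
    (hN : IsUnitNormal X p N) : ∃ t ∈ adaptedFrames X, t.1 = p ∧ t.2.1 = N := by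
  obtain ⟨e, he, hpe⟩ := exists_orthonormal_inner_eq_zero p
  exact ⟨(p, ⟨N, by simpa using hN.norm_eq_one⟩, e), ⟨hN, he, hpe⟩, rfl, rfl⟩

theorem of_bilin_eq_transpose_mul_mul
    (B : EuclideanSpace ℝ (Fin n) →ₗ[ℝ] EuclideanSpace ℝ (Fin n) →ₗ[ℝ] ℝ)
    (v : Fin n → EuclideanSpace ℝ (Fin n)) :
    (Matrix.of fun i j => B (v i) (v j)) = (Matrix.of fun k i => v i k)ᵀ *
      Matrix.of (fun i j => B (EuclideanSpace.single i 1) (EuclideanSpace.single j 1)) *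
      Matrix.of fun k i => v i k := by
  ext i j
  rw [Matrix.of_apply, bilin_eq_dotProduct_mulVec, Matrix.mul_assoc]
  rfl

variable {g : C2Metric n} {t : Sn n × Sn n × (Fin n → Sn n)}

theorem exists_frameForms_eq_congruence (hX : IsC2IsometricImmersion g X)
    (ht : t ∈ adaptedFrames X) :
    ∃ P : Matrix (Fin n) (Fin n) ℝ, IsUnit P.det ∧ frameForms X t =
      (Pᵀ * chartMetric g t.1 (extChartAt (𝓡 n) t.1 t.1) * P,
        Pᵀ * secondFundamentalForm X t.1 t.2.1 * P) := by
  obtain ⟨p, N, e⟩ := t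
  obtain ⟨hN, he, hpe⟩ := ht
  have h_range : ∀ i, ∃ v, coordVector p v = e i := fun i =>
    (range_coordVector p).ge (hpe i)
  choose v hv using h_range
  let P := Matrix.of fun k i => v i k
  let D := fderiv ℝ (X ∘ (extChartAt (𝓡 n) p).symm) (extChartAt (𝓡 n) p p)
  let D₂ := fderiv ℝ (fderiv ℝ (X ∘ (extChartAt (𝓡 n) p).symm)) (extChartAt (𝓡 n) p p)
  have h_gram : (Matrix.of fun i j => ⟪coordVector p (v i), coordVector p (v j)⟫) = Pᵀ * _ * P :=
    of_bilin_eq_transpose_mul_mul ((innerₗ _).compl₁₂ (coordVector p).toLinearMap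
      (coordVector p).toLinearMap) v
  have h_fst : (Matrix.of fun i j => ⟪D (v i), D (v j)⟫) = Pᵀ * Matrix.of (fun i j =>
      ⟪D (EuclideanSpace.single i 1), D (EuclideanSpace.single j 1)⟫) * P :=
    of_bilin_eq_transpose_mul_mul ((innerₗ _).compl₁₂ D.toLinearMap D.toLinearMap) v
  have h_snd : (Matrix.of fun i j => -⟪D₂ (v i) (v j), N⟫) = Pᵀ * Matrix.of (fun i j =>
      -⟪D₂ (EuclideanSpace.single i 1) (EuclideanSpace.single j 1), N⟫) * P :=
    of_bilin_eq_transpose_mul_mul (-D₂.toLinearMap₁₂.compr₂ ((innerₗ _).flip N)) v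
  refine ⟨P, isUnit_det_of_transpose_mul_mul_eq_one (h_gram.symm.trans ?_), Prod.ext ?_ ?_⟩
  · ext i j
    simpa only [hv, Matrix.of_apply, Matrix.one_apply] using orthonormal_iff_ite.1 he i j
  · rw [chartMetric_eq_gram hX]
    refine Eq.trans (Matrix.ext fun i j => ?_) h_fst
    simp only [frameForms, Matrix.of_apply, D, fderiv_comp_extChartAt_symm_self hX.contMDiff, hv]
  · refine Eq.trans (Matrix.ext fun i j => ?_) (h_snd.trans ?_)
    · simp only [frameForms, Matrix.of_apply, D₂, hv,
        inner_fderiv_fderiv_comp_extChartAt_symm hX.contMDiff p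
          ((isUnitNormal_iff hX.contMDiff).1 hN).2]
    · congr 2
      ext i j
      simp only [secondFundamentalForm, Matrix.of_apply, D₂,
        partialDeriv_partialDeriv (contDiff_comp_extChartAt_symm hX.contMDiff p)]

end Frames

section Extrema

theorem continuousOn_tensorNorm_gaussRicci {n : ℕ} :
    ContinuousOn (fun q : Matrix (Fin n) (Fin n) ℝ × Matrix (Fin n) (Fin n) ℝ =>
      tensorNorm q.1 (gaussRicci q.1 q.2)) {q | IsUnit q.1.det} := by
  intro q hq
  have h_inv : ContinuousAt
      (fun q : Matrix (Fin n) (Fin n) ℝ × Matrix (Fin n) (Fin n) ℝ => q.1⁻¹) q :=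
    (continuousAt_matrix_inv q.1 (NormedRing.inverse_continuousAt hq.unit)).comp continuousAt_fst
  have h_cont : Continuous fun x : Matrix (Fin n) (Fin n) ℝ × Matrix (Fin n) (Fin n) ℝ =>
      √(∑ i, ∑ j, ∑ k, ∑ l, x.1 i k * x.1 j l *
        ((x.1 * x.2).trace • x.2 - x.2 * x.1 * x.2) i j *
        ((x.1 * x.2).trace • x.2 - x.2 * x.1 * x.2) k l) := by fun_prop
  exact (h_cont.continuousAt.comp (h_inv.prodMk continuousAt_snd)).continuousWithinAt

theorem continuousOn_gaussSectional {m : Type*} [Fintype m] :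
    ContinuousOn (fun x : (Matrix m m ℝ × Matrix m m ℝ) × Matrix m (Fin 2) ℝ =>
      gaussSectional x.1.1 x.1.2 x.2) {x | (x.2ᵀ * x.1.1 * x.2).det ≠ 0} :=
  ContinuousOn.div (Continuous.continuousOn (by fun_prop)) (Continuous.continuousOn (by fun_prop))
    fun _ hx => hx

theorem isCompact_setOf_transpose_mul_self_eq_one {m k : Type*} [Fintype m] [Finite k]
    [DecidableEq k] : IsCompact {Q : Matrix m k ℝ | Qᵀ * Q = 1} := by
  have h_closed : IsClosed {Q : Matrix m k ℝ | Qᵀ * Q = 1} :=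
    isClosed_eq (by fun_prop) continuous_const
  refine (isCompact_univ_pi fun _ => isCompact_univ_pi fun _ => isCompact_Icc).of_isClosed_subset
    (s := Set.univ.pi fun _ : m => Set.univ.pi fun _ : k => Set.Icc (-1 : ℝ) 1) h_closed
    fun Q hQ i _ j _ => ?_
  have h_sum : ∑ l, Q l j * Q l j = 1 := by
    have h_diag := congrFun (congrFun hQ j) j
    rwa [Matrix.one_apply_eq] at h_diag
  have h_le : Q i j * Q i j ≤ 1 := h_sum ▸
    Finset.single_le_sum (f := fun l => Q l j * Q l j) (fun l _ => mul_self_nonneg _)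
      (Finset.mem_univ i)
  exact abs_le.1 (abs_le_one_iff_mul_self_le_one.2 h_le)

theorem nonempty_setOf_transpose_mul_self_eq_one {n : ℕ} (hn : 2 ≤ n) :
    {Q : Matrix (Fin n) (Fin 2) ℝ | Qᵀ * Q = 1}.Nonempty := by
  refine ⟨(1 : Matrix (Fin n) (Fin n) ℝ).submatrix id (Fin.castLE hn), ?_⟩
  have h : ((1 : Matrix (Fin n) (Fin n) ℝ).submatrix id (Fin.castLE hn))ᵀ *
      (1 : Matrix (Fin n) (Fin n) ℝ).submatrix id (Fin.castLE hn) =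
      ((1 : Matrix (Fin n) (Fin n) ℝ)ᵀ * 1).submatrix (Fin.castLE hn) (Fin.castLE hn) := rfl
  rw [Set.mem_ofPred_eq, h, Matrix.transpose_one, Matrix.one_mul,
    Matrix.submatrix_one _ (Fin.castLE_injective hn)]

variable {n : ℕ} {g : C2Metric n} {X : Sn n → EuclideanSpace ℝ (Fin (n + 1))}
  {t : Sn n × Sn n × (Fin n → Sn n)}

theorem mem_sectionalCurvatures_iff (hX : IsC2IsometricImmersion g X) {k : ℝ} :
    k ∈ sectionalCurvatures g ↔ ∃ p N, ∃ Q : Matrix (Fin n) (Fin 2) ℝ, IsUnitNormal X p N ∧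
      Function.Injective Q.mulVec ∧ k = gaussSectional (chartMetric g p (extChartAt (𝓡 n) p p))
        (secondFundamentalForm X p N) Q := by
  have h_col : ∀ u v : Fin n → ℝ, LinearIndependent ℝ ![u, v] ↔
      Function.Injective (Matrix.of ![u, v])ᵀ.mulVec := fun u v =>
    (Matrix.mulVec_injective_iff (M := (Matrix.of ![u, v])ᵀ)).symm
  refine ⟨?_, ?_⟩
  · rintro ⟨p, u, v, huv, rfl⟩
    obtain ⟨N, hN⟩ := exists_isUnitNormal X p
    exact ⟨p, N, _, hN, (h_col u v).1 huv, sectional_chartMetric hX hN u v⟩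
  · rintro ⟨p, N, Q, hN, hQ, rfl⟩
    have h_eq : (Matrix.of ![Q.col 0, Q.col 1])ᵀ = Q :=
      Matrix.ext fun i j => by fin_cases j <;> rfl
    refine ⟨p, Q.col 0, Q.col 1, (h_col _ _).2 (by rwa [h_eq]), ?_⟩
    rw [sectional_chartMetric hX hN, h_eq]

theorem posDef_frameForms_fst (hX : IsC2IsometricImmersion g X) (ht : t ∈ adaptedFrames X) :
    (frameForms X t).1.PosDef := by
  obtain ⟨P, hP, h_eq⟩ := exists_frameForms_eq_congruence hX ht
  have h := (posDef_chartMetric g t.1 (extChartAt (𝓡 n) t.1 t.1)).conjTranspose_mul_mul_same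
    (Matrix.mulVec_injective_of_isUnit ((Matrix.isUnit_iff_isUnit_det P).2 hP))
  rwa [h_eq, ← Matrix.conjTranspose_eq_transpose_of_trivial]

theorem ricciNorm_eq_of_mem_adaptedFrames (hX : IsC2IsometricImmersion g X)
    (ht : t ∈ adaptedFrames X) : ricciNorm g t.1 =
      tensorNorm (frameForms X t).1 (gaussRicci (frameForms X t).1 (frameForms X t).2) := by
  obtain ⟨P, hP, h_eq⟩ := exists_frameForms_eq_congruence hX ht
  rw [h_eq, gaussRicci_congruence hP, tensorNorm_congruence hP, ricciNorm,
    ricci_chartMetric hX ht.1]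

theorem range_ricciNorm (hX : IsC2IsometricImmersion g X) : Set.range (ricciNorm g) =
    (fun q => tensorNorm q.1 (gaussRicci q.1 q.2)) '' (frameForms X '' adaptedFrames X) := by
  rw [Set.image_image]
  refine subset_antisymm ?_ ?_
  · rintro _ ⟨p, rfl⟩
    obtain ⟨N, hN⟩ := exists_isUnitNormal X p
    obtain ⟨t, ht, rfl, -⟩ := exists_mem_adaptedFrames hN
    exact ⟨t, ht, (ricciNorm_eq_of_mem_adaptedFrames hX ht).symm⟩
  · rintro _ ⟨t, ht, rfl⟩
    exact ⟨t.1, ricciNorm_eq_of_mem_adaptedFrames hX ht⟩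

theorem sectionalCurvatures_eq_image (hX : IsC2IsometricImmersion g X) : sectionalCurvatures g =
    (fun x => gaussSectional x.1.1 x.1.2 x.2) ''
      ((frameForms X '' adaptedFrames X) ×ˢ {Q | Qᵀ * Q = 1}) := by
  have h_inj : ∀ {P : Matrix (Fin n) (Fin n) ℝ} {Q : Matrix (Fin n) (Fin 2) ℝ}, IsUnit P →
      Function.Injective Q.mulVec → Function.Injective (P * Q).mulVec := fun {P Q} hP hQ => by
    simpa only [Function.comp_def, Matrix.mulVec_mulVec] using
      (Matrix.mulVec_injective_of_isUnit hP).comp hQ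
  ext k
  rw [mem_sectionalCurvatures_iff hX]
  refine ⟨?_, ?_⟩
  · rintro ⟨p, N, Q, hN, hQ, rfl⟩
    obtain ⟨t, ht, rfl, rfl⟩ := exists_mem_adaptedFrames hN
    obtain ⟨P, hP, h_eq⟩ := exists_frameForms_eq_congruence hX ht
    obtain ⟨R, hR, hQR⟩ := exists_mul_transpose_mul_self_eq_one
      (h_inj (Matrix.isUnit_nonsing_inv_iff.2 ((Matrix.isUnit_iff_isUnit_det P).2 hP)) hQ)
    refine ⟨(frameForms X t, P⁻¹ * Q * R), ⟨⟨t, ht, rfl⟩, hQR⟩, ?_⟩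
    beta_reduce
    rw [h_eq, gaussSectional_mul_right _ _ _ hR, gaussSectional_congruence,
      Matrix.mul_nonsing_inv_cancel_left _ _ hP]
  · rintro ⟨⟨_, Q⟩, ⟨⟨t, ht, rfl⟩, hQ⟩, rfl⟩
    obtain ⟨P, hP, h_eq⟩ := exists_frameForms_eq_congruence hX ht
    refine ⟨t.1, t.2.1, P * Q, ht.1, h_inj ((Matrix.isUnit_iff_isUnit_det P).2 hP)
      (mulVec_injective_of_transpose_mul_mul_eq_one (A := 1) ?_), ?_⟩
    · rwa [Matrix.mul_one]
    · rw [← gaussSectional_congruence, h_eq]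

theorem exists_isGreatest_range_ricciNorm (hX : IsC2IsometricImmersion g X) :
    ∃ Λ, IsGreatest (Set.range (ricciNorm g)) Λ := by
  have h_compact := (isCompact_adaptedFrames hX.contMDiff).image
    (continuous_frameForms hX.contMDiff)
  have h_cont := continuousOn_tensorNorm_gaussRicci.mono
    (show frameForms X '' adaptedFrames X ⊆ {q | IsUnit q.1.det} by
      rintro _ ⟨t, ht, rfl⟩
      exact (posDef_frameForms_fst hX ht).det_pos.ne'.isUnit)
  refine IsCompact.exists_isGreatest ?_ ⟨_, Set.mem_range_self (radialRetraction 0)⟩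
  rw [range_ricciNorm hX]
  exact h_compact.image_of_continuousOn h_cont

theorem exists_isLeast_sectionalCurvatures (hn : 2 ≤ n) (hX : IsC2IsometricImmersion g X) :
    ∃ κ, IsLeast (sectionalCurvatures g) κ := by
  have h_compact := ((isCompact_adaptedFrames hX.contMDiff).image
    (continuous_frameForms hX.contMDiff)).prod
      (isCompact_setOf_transpose_mul_self_eq_one (m := Fin n) (k := Fin 2))
  have h_cont := continuousOn_gaussSectional.mono
    (show (frameForms X '' adaptedFrames X) ×ˢ {Q : Matrix (Fin n) (Fin 2) ℝ | Qᵀ * Q = 1} ⊆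
        {x | (x.2ᵀ * x.1.1 * x.2).det ≠ 0} by
      rintro ⟨_, Q⟩ ⟨⟨t, ht, rfl⟩, hQ⟩
      have h_pos := (posDef_frameForms_fst hX ht).conjTranspose_mul_mul_same
        (mulVec_injective_of_transpose_mul_mul_eq_one (A := 1) (Q := Q) (by rwa [Matrix.mul_one]))
      exact h_pos.det_pos.ne')
  obtain ⟨N, hN⟩ := exists_isUnitNormal X (radialRetraction 0)
  obtain ⟨t, ht, -⟩ := exists_mem_adaptedFrames hN
  have h_nonempty : (frameForms X '' adaptedFrames X).Nonempty := ⟨_, t, ht, rfl⟩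
  rw [sectionalCurvatures_eq_image hX]
  exact (h_compact.image_of_continuousOn h_cont).exists_isLeast
    ((h_nonempty.prod (nonempty_setOf_transpose_mul_self_eq_one hn)).image _)

end Extrema

/-! ### The estimate -/

theorem sqrt_mul_secondFundamentalFormNorm_le_ricciNorm {n : ℕ} {g : C2Metric n}
    {X : Sn n → EuclideanSpace ℝ (Fin (n + 1))} (hX : IsC2IsometricImmersion g X) {p : Sn n}
    {N : EuclideanSpace ℝ (Fin (n + 1))} (hN : IsUnitNormal X p N) {κ : ℝ}
    (hκ : κ ∈ lowerBounds (sectionalCurvatures g)) :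
    √(((n : ℝ) - 1) * ((n : ℝ) - 2) * κ) * secondFundamentalFormNorm g X p N ≤ ricciNorm g p := by
  rw [secondFundamentalFormNorm, ricciNorm, ricci_chartMetric hX hN]
  refine tensorNorm_le_tensorNorm_gaussRicci (posDef_chartMetric g p _)
    (isSymm_secondFundamentalForm hX.contMDiff p N) fun Q hQ => ?_
  have h := hκ ((mem_sectionalCurvatures_iff hX).2
    ⟨p, N, Q, hN, mulVec_injective_of_transpose_mul_mul_eq_one hQ, rfl⟩)
  rwa [gaussSectional, hQ, Matrix.det_one, div_one] at h

theorem div_sqrt_mul_le_div_two_mul_sqrt_mul_rpow {a r Λ κ : ℝ} (ha : 0 ≤ a) (hr : 2 ≤ r)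
    (hΛ : 0 ≤ Λ) (hκ : 0 ≤ κ) : Λ / √(a * κ) ≤ r / (2 * √a) * Λ * κ ^ (-(1 / 2) : ℝ) := by
  rw [Real.rpow_neg hκ, ← Real.sqrt_eq_rpow]
  calc Λ / √(a * κ) = 1 * (Λ / (√a * √κ)) := by rw [Real.sqrt_mul ha, one_mul]
    _ ≤ r / 2 * (Λ / (√a * √κ)) := by gcongr; linarith
    _ = r / (2 * √a) * Λ * (√κ)⁻¹ := by ring

theorem theorem5p5_general {n : ℕ} (hn : 3 ≤ n) {g : C2Metric n}
    (hg : ∀ k ∈ sectionalCurvatures g, 0 < k) {X : Sn n → EuclideanSpace ℝ (Fin (n + 1))}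
    (hX : IsC2IsometricImmersion g X) :
    ∃ κ Λ : ℝ, IsLeast (sectionalCurvatures g) κ ∧ IsGreatest (Set.range (ricciNorm g)) Λ ∧
      ∀ (p : Sn n) (N : EuclideanSpace ℝ (Fin (n + 1))), IsUnitNormal X p N →
        secondFundamentalFormNorm g X p N ≤
          (n : ℝ) / (2 * √(((n : ℝ) - 1) * ((n : ℝ) - 2))) * Λ * κ ^ (-(1 / 2) : ℝ) := by
  obtain ⟨κ, hκ⟩ := exists_isLeast_sectionalCurvatures (by lia) hX
  obtain ⟨Λ, hΛ⟩ := exists_isGreatest_range_ricciNorm hX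
  have hn' : (3 : ℝ) ≤ n := by exact_mod_cast hn
  have hκ_pos : 0 < κ := hg κ hκ.1
  have h_pos : 0 < ((n : ℝ) - 1) * ((n : ℝ) - 2) := mul_pos (by linarith) (by linarith)
  refine ⟨κ, Λ, hκ, hΛ, fun p N hN => ?_⟩
  have h_ricci : ricciNorm g p ≤ Λ := hΛ.2 ⟨p, rfl⟩
  have hΛ_nonneg : 0 ≤ Λ := (Real.sqrt_nonneg _).trans h_ricci
  calc secondFundamentalFormNorm g X p N
      ≤ Λ / √(((n : ℝ) - 1) * ((n : ℝ) - 2) * κ) := by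
        rw [le_div_iff₀' (Real.sqrt_pos.2 (mul_pos h_pos hκ_pos))]
        exact (sqrt_mul_secondFundamentalFormNorm_le_ricciNorm hX hN hκ.2).trans h_ricci
    _ ≤ _ := div_sqrt_mul_le_div_two_mul_sqrt_mul_rpow h_pos.le (by linarith) hΛ_nonneg hκ_pos.le

theorem theorem5p5 (n : ℕ) (hn : 3 ≤ n) (g : C2Metric n)
    (hg : ∀ k ∈ sectionalCurvatures g, 0 < k)
    (X : Sn n → EuclideanSpace ℝ (Fin (n + 1))) (hX : IsC2IsometricEmbedding g X) :
    ∃ κ Λ : ℝ, IsLeast (sectionalCurvatures g) κ ∧ IsGreatest (Set.range (ricciNorm g)) Λ ∧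
      ∀ (p : Sn n) (N : EuclideanSpace ℝ (Fin (n + 1))), IsUnitNormal X p N →
        secondFundamentalFormNorm g X p N ≤
          (n : ℝ) / (2 * Real.sqrt (((n : ℝ) - 1) * ((n : ℝ) - 2))) * Λ * κ ^ (-(1 / 2) : ℝ) :=
  theorem5p5_general hn hg hX.isC2IsometricImmersion
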